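/- **Graphs with Euclidean edges.** A graph with Euclidean edges $\mathcal G=(\mathcal V,\mathcal E,\{\varphi_e\}_{e\in\mathcal E})$ consists of a finite simple connected graph $(\mathcal V,\mathcal E)$ in which every edge $e$ is also a set (its points), the sets $\mathcal V$ and $e\in\mathcal E$ being mutually disjoint, together with, for every edge $e$ joining $u,v\in\mathcal V$, a bijection $\varphi_e$ from $e\cup\{u,v\}$ onto a compact interval $[\underline e,\overline e]$, $\underline e<\overline e$, which maps $e$ onto $(\underline e,\overline e)$ and $\{u,v\}$ onto $\{\underline e,\overline e\}$. Put $\mathrm{len}(e)=\overline e-\underline e$; it is required that for every edge $e$ joining $u$ and $v$ the shortest-path distance of $u,v$ in the graph with edge weights $\mathrm{len}$ equals $\mathrm{len}(e)$. The points of $\mathcal G$ are the elements of $\mathcal V\cup\bigcup_{e\in\mathcal E} e$. $\mathcal G$ is a Euclidean tree (cycle) if $(\mathcal V,\mathcal E)$ is a tree (a cycle with at least three vertices). **Geodesic metric.** $d_{G,\mathcal G}(u,v)$ is the infimum of the lengths of all paths from $u$ to $v$. A path is a sequence of pairwise distinct points $u=u_1,\dots,u_{n+1}=v$ with non-overlapping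 partial edges $p_1,\dots,p_n$, where $p_i=\varphi_{e_i}^{-1}(I_i)$ for an edge $e_i$ and an interval $I_i\subseteq(\underline e_i,\overline e_i)$ whose two endpoints are the $\varphi_{e_i}$-coordinates of $u_i$ and $u_{i+1}$; its length is the sum of the lengths of the $I_i$. In particular $d_{G,\mathcal G}(u,u)=0$. **Resistance metric.** Let $c(u,v)=1/\mathrm{len}(e)$ if the vertices $u,v$ are joined by an edge $e$, and $c(u,v)=0$ otherwise. Fix an origin $u_o\in\mathcal V$ and let $L$ be the $\mathcal V\times\mathcal V$ matrix with $L(u,u)=\sum_w c(u,w)$ for $u\ne u_o$, $L(u_o,u_o)=1+\sum_w c(u_o,w)$, and $L(u,v)=-c(u,v)$ for $u\neq v$. Let $Z_{\mathcal G}=Z_\mu+\sum_{e\in\mathcal E}Z_e$, where the summands are independent centred Gaussian fields on $\mathcal G$: $(Z_\mu(v))_{v\in\mathcal V}\sim N(0,L^{-1})$ and $Z_\mu$ is extended to each edge by linear interpolation in the coordinate $\varphi_e$; and $Z_e(u)=B_e(\varphi_e(u))$ for $u\in e$, with $B_e$ a Brownian bridge on $[\underline e,\overline e]$, and $Z_e(u)=0$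 for $u\notin e$. Then $d_{R,\mathcal G}(u,v)=\mathrm{Var}(Z_{\mathcal G}(u)-Z_{\mathcal G}(v))$. **1-sums.** If distance spaces $(X_1,d_1)$ and $(X_2,d_2)$ satisfy $X_1\cap X_2=\{x_0\}$, their 1-sum is $X_1\cup X_2$ with the distance $d$ that equals $d_i$ on $X_i$ and satisfies $d(x,y)=d(y,x)=d_1(x,x_0)+d_2(x_0,y)$ for $x\in X_1$, $y\in X_2$. $\mathcal G$ forms a finite sequential 1-sum of Euclidean cycles and trees if $(\mathcal G,d_{G,\mathcal G})$ is obtained from one Euclidean cycle or tree by finitely many (possibly no) successive 1-sums with Euclidean cycles or trees, each of these with its geodesic metric. **Radial profiles.** Consider the functions $C:[0,\infty)\to\mathbb R$ of the following four classes. * Power exponential: $C(t)=\exp(-\beta t^\alpha)$, with $0<\alpha\le1$, $\beta>0$. * Matérn: $C(t)=(\beta t)^\alpha K_\alpha(\beta t)$ for $t>0$, extended by continuity to $C(0)=2^{\alpha-1}\Gamma(\alpha)$, with $0<\alpha\le\frac12$, $\beta>0$; here $K_\alpha(x)=\int_0^\infty e^{-x\cosh s}\cosh(\alpha s)\,ds$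 is the modified Bessel function of the second kind. * Generalized Cauchy: $C(t)=(\beta t^\alpha+1)^{-\xi/\alpha}$, with $0<\alpha\le1$, $\beta,\xi>0$. * Dagum: $C(t)=1-\Big(\dfrac{\beta t^\alpha}{1+\beta t^\alpha}\Big)^{\xi/\alpha}$, with $0<\alpha\le1$, $0<\xi\le1$, $\beta>0$. **Theorem.** Let $\mathcal G$ be a graph with Euclidean edges and let $C$ belong to one of these four classes. Then: 1. for every choice of the origin $u_o$, $C(d_{R,\mathcal G}(u,v))$ is strictly positive definite over $(u,v)\in\mathcal G\times\mathcal G$; 2. if $\mathcal G$ forms a finite sequential 1-sum of Euclidean cycles and trees, then $C(d_{G,\mathcal G}(u,v))$ is strictly positive definite over $(u,v)\in\mathcal G\times\mathcal G$. Here a symmetric function $k$ on $\mathcal G\times\mathcal G$ is strictly positive definite if $\sum_{i,j}a_ia_jk(x_i,x_j)>0$ for all finite families of distinct points $x_i\in\mathcal G$ and all real $a_i$ that are not all zero. -/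

import Mathlib

universe u

noncomputable section

/-- The shortest-path metric on the vertices of a graph `H` with edge weights `w`. -/
def weightedGraphDist {V : Type u} (H : SimpleGraph V) (w : Sym2 V → ℝ) (a b : V) : ℝ :=
  sInf {r : ℝ | ∃ p : H.Walk a b, r = (p.edges.map w).sum}

/-- A graph with Euclidean edges whose set of points (vertices together with all points on edges)
is the type `X`.  The edge-indexed data are total functions on `Sym2 verts`; only their values at
elements of `graph.edgeSet` are constrained or used. -/
structure EuclideanGraph (X : Type u) where
  /-- the finite vertex set -/
  verts : Finset X
  /-- the adjacency structure: a simple graph on the vertices -/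
  graph : SimpleGraph verts
  connected : graph.Connected
  /-- the set of (interior) points of an edge -/
  edgePts : Sym2 verts → Set X
  edgePts_disjoint : graph.edgeSet.PairwiseDisjoint edgePts
  edgePts_disjoint_verts : ∀ e ∈ graph.edgeSet, Disjoint (edgePts e) (verts : Set X)
  cover : ∀ x : X, x ∈ verts ∨ ∃ e ∈ graph.edgeSet, x ∈ edgePts e
  /-- the lower endpoint of the coordinate interval of an edge -/
  lo : Sym2 verts → ℝ
  /-- the upper endpoint of the coordinate interval of an edge -/
  hi : Sym2 verts → ℝ
  lo_lt_hi : ∀ e ∈ graph.edgeSet, lo e < hi e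
  /-- the coordinate of an edge; it matters only on the edge and its two end vertices -/
  coord : Sym2 verts → X → ℝ
  coord_bijOn : ∀ e ∈ graph.edgeSet, Set.BijOn (coord e) (edgePts e) (Set.Ioo (lo e) (hi e))
  /-- the end vertex with coordinate `lo e` -/
  tail : Sym2 verts → verts
  /-- the end vertex with coordinate `hi e` -/
  head : Sym2 verts → verts
  endpoints : ∀ e ∈ graph.edgeSet, e = s(tail e, head e)
  coord_tail : ∀ e ∈ graph.edgeSet, coord e (tail e) = lo e
  coord_head : ∀ e ∈ graph.edgeSet, coord e (head e) = hi e
  /-- distance consistency -/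
  consistent : ∀ a b : verts, graph.Adj a b →
    weightedGraphDist graph (fun e => hi e - lo e) a b = hi s(a, b) - lo s(a, b)

namespace EuclideanGraph

variable {X : Type u} (G : EuclideanGraph X)

/-- A Euclidean tree. -/
def IsEuclideanTree : Prop := G.graph.IsTree

/-- A Euclidean cycle. -/
def IsEuclideanCycle : Prop :=
  ∃ n : ℕ, 3 ≤ n ∧ Nonempty (G.graph ≃g SimpleGraph.cycleGraph n)

/-- The length of an edge. -/
def len (e : Sym2 G.verts) : ℝ := G.hi e - G.lo e

/-- An edge together with its two end vertices. -/
def closedEdge (e : Sym2 G.verts) : Set X :=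
  G.edgePts e ∪ {(G.tail e : X), (G.head e : X)}

/-- The (open) partial edge of the edge `e` with boundary `{x, y}`, for `x, y ∈ G.closedEdge e`. -/
def partialEdge (e : Sym2 G.verts) (x y : X) : Set X :=
  {z ∈ G.edgePts e | G.coord e z ∈ Set.uIoo (G.coord e x) (G.coord e y)}

/-- A path from `x` to `y`: pairwise distinct points `pts 0 = x, …, pts n = y`, successive points
being joined by non-overlapping partial edges.  For `x = y` only the trivial path (`n = 0`)
occurs. -/
structure EPath (x y : X) where
  n : ℕ
  pts : Fin (n + 1) → X
  edge : Fin n → Sym2 G.verts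
  pts_zero : pts 0 = x
  pts_last : pts (Fin.last n) = y
  pts_injective : Function.Injective pts
  edge_mem : ∀ i, edge i ∈ G.graph.edgeSet
  left_mem : ∀ i, pts i.castSucc ∈ G.closedEdge (edge i)
  right_mem : ∀ i, pts i.succ ∈ G.closedEdge (edge i)
  nonoverlapping : ∀ i j, i ≠ j →
    Disjoint (G.partialEdge (edge i) (pts i.castSucc) (pts i.succ))
      (G.partialEdge (edge j) (pts j.castSucc) (pts j.succ))

variable {G} in
/-- The length of a path: the sum of the lengths of its partial edges. -/
def EPath.length {x y : X} (p : G.EPath x y) : ℝ :=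
  ∑ i, |G.coord (p.edge i) (p.pts i.succ) - G.coord (p.edge i) (p.pts i.castSucc)|

/-- The geodesic metric. -/
def geodesicDist (x y : X) : ℝ := sInf {r : ℝ | ∃ p : G.EPath x y, r = p.length}

open Classical in
/-- The conductance between two vertices. -/
def conductance (a b : G.verts) : ℝ := if G.graph.Adj a b then 1 / G.len s(a, b) else 0

open Classical in
/-- The Laplacian matrix of the network, with an additional `1` at the origin `o`. -/
def laplacian (o : G.verts) : Matrix G.verts G.verts ℝ := Matrix.of fun a b =>
  if a = b then (if a = o then 1 + ∑ c, G.conductance a c else ∑ c, G.conductance a c)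
  else -G.conductance a b

lemma exists_edge_of_notMem {x : X} (hx : x ∉ G.verts) :
    ∃ e, e ∈ G.graph.edgeSet ∧ x ∈ G.edgePts e := by
  rcases G.cover x with h | ⟨e, he, hxe⟩
  · exact absurd h hx
  · exact ⟨e, he, hxe⟩

/-- The edge containing a point that is not a vertex. -/
def edgeOf (x : X) (hx : x ∉ G.verts) : Sym2 G.verts := (G.exists_edge_of_notMem hx).choose

open Classical in
/-- The lower neighbouring vertex of a point (a vertex is its own neighbour). -/
def lowerVert (x : X) : G.verts :=
  if hx : x ∈ G.verts then ⟨x, hx⟩ else G.tail (G.edgeOf x hx)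

open Classical in
/-- The upper neighbouring vertex of a point (a vertex is its own neighbour). -/
def upperVert (x : X) : G.verts :=
  if hx : x ∈ G.verts then ⟨x, hx⟩ else G.head (G.edgeOf x hx)

open Classical in
/-- The distance of a point from its lower neighbouring vertex, as a proportion of the length of
the edge that contains the point; `0` at vertices. -/
def frac (x : X) : ℝ :=
  if hx : x ∈ G.verts then 0
  else (G.coord (G.edgeOf x hx) x - G.lo (G.edgeOf x hx)) / G.len (G.edgeOf x hx)

open Classical in
/-- The covariance function of the Gaussian field `Z_μ`, which has the law `N(0, L⁻¹)` at the
vertices and is interpolated linearly along the edges. -/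
def covVertex (o : G.verts) (x y : X) : ℝ :=
  G.frac x * G.frac y * (G.laplacian o)⁻¹ (G.upperVert x) (G.upperVert y)
    + (1 - G.frac x) * (1 - G.frac y) * (G.laplacian o)⁻¹ (G.lowerVert x) (G.lowerVert y)
    + G.frac x * (1 - G.frac y) * (G.laplacian o)⁻¹ (G.upperVert x) (G.lowerVert y)
    + (1 - G.frac x) * G.frac y * (G.laplacian o)⁻¹ (G.lowerVert x) (G.upperVert y)

open Classical in
/-- The covariance function of the field `Z_e`, a Brownian bridge over the edge `e`, and zero
off `e`. -/
def covEdge (e : Sym2 G.verts) (x y : X) : ℝ :=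
  if x ∈ G.edgePts e ∧ y ∈ G.edgePts e then
    (min (G.frac x) (G.frac y) - G.frac x * G.frac y) * G.len e
  else 0

open Classical in
/-- The covariance function of the centred Gaussian field `Z_G = Z_μ + ∑ e, Z_e`, the summands
being independent. -/
def cov (o : G.verts) (x y : X) : ℝ :=
  G.covVertex o x y + ∑ e ∈ G.graph.edgeFinset, G.covEdge e x y

/-- The resistance metric: the variogram `var (Z_G(x) - Z_G(y))`. -/
def resistanceDist (o : G.verts) (x y : X) : ℝ :=
  G.cov o x x + G.cov o y y - 2 * G.cov o x y

end EuclideanGraph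

/-- `(X, d)` is a finite sequential 1-sum of Euclidean cycles and trees, each of them with its own
geodesic metric. -/
inductive IsSeqOneSum : (X : Type u) → (X → X → ℝ) → Prop
  /-- a single Euclidean cycle or tree -/
  | single {X : Type u} (d : X → X → ℝ) (H : EuclideanGraph X)
      (hH : H.IsEuclideanCycle ∨ H.IsEuclideanTree)
      (hd : ∀ x y, d x y = H.geodesicDist x y) : IsSeqOneSum X d
  /-- the 1-sum of a space `A` already obtained and a Euclidean cycle or tree `B` at `x₀` -/
  | oneSum {X : Type u} (d : X → X → ℝ) (A B : Set X) (x₀ : X)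
      (hunion : A ∪ B = Set.univ) (hinter : A ∩ B = {x₀})
      (hA : IsSeqOneSum A (fun x y => d x y))
      (H : EuclideanGraph B) (hH : H.IsEuclideanCycle ∨ H.IsEuclideanTree)
      (hB : ∀ x y : B, d x y = H.geodesicDist x y)
      (hAB : ∀ x ∈ A, ∀ y ∈ B, d x y = d x x₀ + d x₀ y)
      (hBA : ∀ x ∈ A, ∀ y ∈ B, d y x = d x x₀ + d x₀ y) : IsSeqOneSum X d

/-- The modified Bessel function of the second kind `K_ν(x)`, for `x > 0`. -/
def besselK (ν x : ℝ) : ℝ :=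
  ∫ t in Set.Ioi (0 : ℝ), Real.exp (-x * Real.cosh t) * Real.cosh (ν * t)

/-- Power exponential profiles. -/
def IsPowerExponential (C : ℝ → ℝ) : Prop :=
  ∃ α β : ℝ, 0 < α ∧ α ≤ 1 ∧ 0 < β ∧ ∀ t, 0 ≤ t → C t = Real.exp (-β * t ^ α)

/-- Matérn profiles; the value at `0` is the limit of `(β t) ^ α * K_α (β t)` as `t ↓ 0`. -/
def IsMatern (C : ℝ → ℝ) : Prop :=
  ∃ α β : ℝ, 0 < α ∧ α ≤ 1 / 2 ∧ 0 < β ∧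
    C 0 = 2 ^ (α - 1) * Real.Gamma α ∧
    ∀ t, 0 < t → C t = (β * t) ^ α * besselK α (β * t)

/-- Generalized Cauchy profiles. -/
def IsGeneralizedCauchy (C : ℝ → ℝ) : Prop :=
  ∃ α β ξ : ℝ, 0 < α ∧ α ≤ 1 ∧ 0 < β ∧ 0 < ξ ∧
    ∀ t, 0 ≤ t → C t = (β * t ^ α + 1) ^ (-ξ / α)

/-- Dagum profiles. -/
def IsDagum (C : ℝ → ℝ) : Prop :=
  ∃ α β ξ : ℝ, 0 < α ∧ α ≤ 1 ∧ 0 < β ∧ 0 < ξ ∧ ξ ≤ 1 ∧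
    ∀ t, 0 ≤ t → C t = 1 - (β * t ^ α / (1 + β * t ^ α)) ^ (ξ / α)

/-- `C`, regarded as a function on `[0, ∞)`, belongs to one of the four parametric classes. -/
def IsRadialProfile (C : ℝ → ℝ) : Prop :=
  IsPowerExponential C ∨ IsMatern C ∨ IsGeneralizedCauchy C ∨ IsDagum C

/-- A kernel on an arbitrary set is strictly positive definite: it is symmetric and
`∑ i j, c i * c j * k (x i) (x j) > 0` for finitely many distinct points `x i` and real
coefficients `c i` that are not all zero. -/
def IsStrictlyPosDef {X : Type u} (k : X → X → ℝ) : Prop := (Matrix.of k).PosDef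

end

noncomputable section

open MeasureTheory Set Filter Topology

/-! ### Positive definite and conditionally negative definite kernels; Schoenberg's theorem. -/

namespace RadialKernel

variable {X : Type u}

/-! Both metrics are variograms: conditionally negative definite, zero on the diagonal and positive
off it, so that their square roots embed in a Hilbert space. This property (`IsShiftedVariogram 0`)
is all that the profiles need (`posDef_of_isRadialProfile`).

For the profiles, Schoenberg's theorem makes `exp (-ψ)` strictly positive definite when ψ is
conditionally negative definite and separates points; strictness comes from the power series of
`exp` and a moment argument (`posDef_exp`). Every other profile is an explicit mixture, with
positive weights, of such exponentials. Gamma integrals give negative powers. A resolvent integral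
gives powers with exponent in (0, 1), which are again conditionally negative definite. The Dagum and
Matérn functions have integral representations of their own. No general theorem on completely
monotone functions is invoked.

The resistance metric is a variogram by construction. It separates points because the interpolated
vertex field already does: the grounded Laplacian is positive definite and a point is determined by
its interpolation weights.

For the geodesic metric, an explicit distance is exhibited in each case and identified with the
infimum over paths by `geodesicDist_eq`. On a tree it is the sum over the edges of the distances of
the projections to that edge, an ℓ¹ metric. On a cycle it is arc length on a circle of length L,
where L/4 minus the distance is positive semidefinite. In a 1-sum the distance is the sum of the
pullbacks of the two given distances along the retractions onto the summands. -/

lemma posSemidef_of_sum {k : X → X → ℝ} (hs : ∀ x y, k x y = k y x)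
    (h : ∀ (s : Finset X) (c : X → ℝ), 0 ≤ ∑ i ∈ s, ∑ j ∈ s, c i * k i j * c j) :
    (Matrix.of k).PosSemidef :=
  ⟨Matrix.IsHermitian.ext fun i j => by simpa using hs j i, fun x => by
    simpa [Finsupp.sum] using h x.support x⟩

lemma sum_nonneg {k : X → X → ℝ} (h : (Matrix.of k).PosSemidef) (s : Finset X) (c : X → ℝ) :
    0 ≤ ∑ i ∈ s, ∑ j ∈ s, c i * k i j * c j := by
  have := (h.submatrix ((↑) : s → X)).dotProduct_mulVec_nonneg (fun i => c i)
  simp only [dotProduct, Matrix.mulVec, Matrix.submatrix_apply, Matrix.of_apply, star_trivial,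
    Pi.star_apply, Finset.mul_sum] at this
  rw [← Finset.sum_coe_sort s]
  simp_rw [← Finset.sum_coe_sort s fun j => c _ * k _ j * c j]
  simpa [mul_assoc] using this

lemma posSemidef_congr {k l : X → X → ℝ} (hl : (Matrix.of l).PosSemidef)
    (h : ∀ x y, k x y = l x y) : (Matrix.of k).PosSemidef := by
  obtain rfl : k = l := funext₂ h
  exact hl

lemma posDef_congr {k l : X → X → ℝ} (hl : (Matrix.of l).PosDef)
    (h : ∀ x y, k x y = l x y) : (Matrix.of k).PosDef := by
  obtain rfl : k = l := funext₂ h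
  exact hl

lemma symm_of_posSemidef {k : X → X → ℝ} (h : (Matrix.of k).PosSemidef) (x y : X) :
    k x y = k y x := by simpa using h.1.apply y x

lemma posDef_of_sum {k : X → X → ℝ} (hs : ∀ x y, k x y = k y x)
    (h : ∀ (s : Finset X) (c : X → ℝ), s.Nonempty → (∀ i ∈ s, c i ≠ 0) →
      0 < ∑ i ∈ s, ∑ j ∈ s, c i * k i j * c j) :
    (Matrix.of k).PosDef :=
  ⟨Matrix.IsHermitian.ext fun i j => by simpa using hs j i, fun x hx => by
    simpa [Finsupp.sum] using h x.support x (by simpa using hx) (by simp)⟩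

lemma sum_pos {k : X → X → ℝ} (h : (Matrix.of k).PosDef) {s : Finset X} {c : X → ℝ}
    (hs : s.Nonempty) (hc : ∀ i ∈ s, c i ≠ 0) :
    0 < ∑ i ∈ s, ∑ j ∈ s, c i * k i j * c j := by
  have hne : (fun i : s => c i) ≠ 0 := by
    obtain ⟨i, hi⟩ := hs
    exact fun h0 => hc i hi (congrFun h0 ⟨i, hi⟩)
  have h1 : ((Matrix.of k).submatrix ((↑) : s → X) (↑)).PosDef :=
    h.submatrix Subtype.coe_injective
  have := h1.dotProduct_mulVec_pos hne
  simp only [dotProduct, Matrix.mulVec, Matrix.submatrix_apply, Matrix.of_apply, star_trivial,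
    Pi.star_apply, Finset.mul_sum] at this
  rw [← Finset.sum_coe_sort s]
  simp_rw [← Finset.sum_coe_sort s fun j => c _ * k _ j * c j]
  simpa [mul_assoc] using this

lemma posSemidef_rankOne (f : X → ℝ) : (Matrix.of fun x y => f x * f y).PosSemidef :=
  posSemidef_of_sum (fun x y => mul_comm _ _) fun s c => by
    have : ∑ i ∈ s, ∑ j ∈ s, c i * (f i * f j) * c j = (∑ i ∈ s, c i * f i) ^ 2 := by
      rw [sq, Finset.sum_mul_sum]
      exact Finset.sum_congr rfl fun i _ => Finset.sum_congr rfl fun j _ => by ring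
    rw [this]; positivity

lemma posSemidef_add {k l : X → X → ℝ} (hk : (Matrix.of k).PosSemidef)
    (hl : (Matrix.of l).PosSemidef) : (Matrix.of fun x y => k x y + l x y).PosSemidef :=
  hk.add hl

lemma posSemidef_sum {ι : Type*} (s : Finset ι) {k : ι → X → X → ℝ}
    (hk : ∀ i ∈ s, (Matrix.of (k i)).PosSemidef) :
    (Matrix.of fun x y => ∑ i ∈ s, k i x y).PosSemidef := by
  have := Matrix.posSemidef_sum s hk
  convert! this using 1
  ext x y
  simp [Matrix.sum_apply]

lemma posSemidef_mul {k l : X → X → ℝ} (hk : (Matrix.of k).PosSemidef)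
    (hl : (Matrix.of l).PosSemidef) : (Matrix.of fun x y => k x y * l x y).PosSemidef :=
  hk.hadamard hl

lemma posSemidef_const_mul {k : X → X → ℝ} (hk : (Matrix.of k).PosSemidef) {a : ℝ} (ha : 0 ≤ a) :
    (Matrix.of fun x y => a * k x y).PosSemidef :=
  hk.smul ha

lemma posDef_const_mul {k : X → X → ℝ} (hk : (Matrix.of k).PosDef) {a : ℝ} (ha : 0 < a) :
    (Matrix.of fun x y => a * k x y).PosDef :=
  hk.smul ha

lemma posSemidef_pow {k : X → X → ℝ} (hk : (Matrix.of k).PosSemidef) (n : ℕ) :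
    (Matrix.of fun x y => k x y ^ n).PosSemidef := by
  induction n with
  | zero => simpa using posSemidef_rankOne (fun _ : X => (1 : ℝ))
  | succ n ih => simpa only [pow_succ] using posSemidef_mul ih hk

lemma posSemidef_comp {Y : Type*} {k : X → X → ℝ} (hk : (Matrix.of k).PosSemidef) (f : Y → X) :
    (Matrix.of fun x y => k (f x) (f y)).PosSemidef :=
  hk.submatrix f

/-- The covariance kernel of the increments from a base point. -/
lemma posSemidef_shift {k : X → X → ℝ} (hk : (Matrix.of k).PosSemidef) (z : X) :
    (Matrix.of fun x y => k x y - k x z - k z y + k z z).PosSemidef := by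
  classical
  refine posSemidef_of_sum (fun x y => ?_) fun s c => ?_
  · rw [symm_of_posSemidef hk x y, symm_of_posSemidef hk x z, symm_of_posSemidef hk z y]; ring
  set S := insert z s with hS
  set d : X → ℝ := fun i => if i ∈ s then c i else 0 with hd
  set σ := ∑ i ∈ s, c i with hσ
  -- Test vector of total mass zero: `c`, extended by zero to `z` if necessary, minus its total mass
  -- `σ` placed at `z`.
  have key := sum_nonneg hk S (fun i => d i - if i = z then σ else 0)
  have hsum : ∀ f : X → ℝ, ∑ i ∈ S, d i * f i = ∑ i ∈ s, c i * f i := fun f => by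
    rw [← Finset.sum_subset (Finset.subset_insert z s)]
    · exact Finset.sum_congr rfl fun i hi => by simp [hd, hi]
    · intro i _ hi; simp [hd, hi]
  have hsum' : ∀ f : X → ℝ, ∑ i ∈ S, (d i - if i = z then σ else 0) * f i
      = ∑ i ∈ s, c i * (f i - f z) := fun f => by
    simp only [sub_mul, Finset.sum_sub_distrib, hsum, mul_sub, ite_mul, zero_mul, ← Finset.sum_mul]
    rw [Finset.sum_ite_eq' S z]
    simp [hS, hσ]
  have e1 : ∑ i ∈ S, ∑ j ∈ S, (d i - if i = z then σ else 0) * k i j *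
      (d j - if j = z then σ else 0) = ∑ i ∈ s, ∑ j ∈ s,
        c i * (k i j - k i z - k z j + k z z) * c j := by
    have : ∀ i, ∑ j ∈ S, (d i - if i = z then σ else 0) * k i j * (d j - if j = z then σ else 0)
        = (d i - if i = z then σ else 0) * ∑ j ∈ s, c j * (k i j - k i z) := fun i => by
      rw [← hsum' (fun j => k i j), Finset.mul_sum]
      exact Finset.sum_congr rfl fun j _ => by ring
    simp_rw [this]
    rw [hsum' fun i => ∑ j ∈ s, c j * (k i j - k i z)]
    refine Finset.sum_congr rfl fun i _ => ?_
    rw [← Finset.sum_sub_distrib, Finset.mul_sum]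
    exact Finset.sum_congr rfl fun j _ => by ring
  rwa [e1] at key

/-- Mixtures of positive semidefinite kernels. -/
lemma posSemidef_integral {S : Type*} [MeasurableSpace S] {μ : Measure S} {K : S → X → X → ℝ}
    (hi : ∀ x y, Integrable (fun s => K s x y) μ) (hK : ∀ᵐ s ∂μ, (Matrix.of (K s)).PosSemidef) :
    (Matrix.of fun x y => ∫ s, K s x y ∂μ).PosSemidef := by
  refine posSemidef_of_sum (fun x y => ?_) fun t c => ?_
  · exact integral_congr_ae (hK.mono fun s hs => symm_of_posSemidef hs x y)
  · have : ∑ i ∈ t, ∑ j ∈ t, c i * (∫ s, K s i j ∂μ) * c j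
        = ∫ s, ∑ i ∈ t, ∑ j ∈ t, c i * K s i j * c j ∂μ := by
      rw [integral_finsetSum _ fun i _ => integrable_finsetSum _ fun j _ =>
        ((hi i j).const_mul _).mul_const _]
      refine Finset.sum_congr rfl fun i _ => ?_
      rw [integral_finsetSum _ fun j _ => ((hi i j).const_mul _).mul_const _]
      exact Finset.sum_congr rfl fun j _ => by rw [integral_mul_const, integral_const_mul]
    rw [this]
    exact integral_nonneg_of_ae (hK.mono fun s hs => sum_nonneg hs t c)

/-- The quadratic form of the mixture is the integral of the quadratic forms. These are positive
almost everywhere, so their integral can vanish only for the zero measure. -/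
lemma posDef_integral {S : Type*} [MeasurableSpace S] {μ : Measure S} {K : S → X → X → ℝ}
    (hμ : μ ≠ 0)
    (hi : ∀ x y, Integrable (fun s => K s x y) μ) (hK : ∀ᵐ s ∂μ, (Matrix.of (K s)).PosDef) :
    (Matrix.of fun x y => ∫ s, K s x y ∂μ).PosDef := by
  refine posDef_of_sum (fun x y => ?_) fun t c ht hc => ?_
  · exact integral_congr_ae (hK.mono fun s hs => symm_of_posSemidef hs.posSemidef x y)
  · have hint : Integrable (fun s => ∑ i ∈ t, ∑ j ∈ t, c i * K s i j * c j) μ :=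
      integrable_finsetSum _ fun i _ => integrable_finsetSum _ fun j _ =>
        ((hi i j).const_mul _).mul_const _
    have : ∑ i ∈ t, ∑ j ∈ t, c i * (∫ s, K s i j ∂μ) * c j
        = ∫ s, ∑ i ∈ t, ∑ j ∈ t, c i * K s i j * c j ∂μ := by
      rw [integral_finsetSum _ fun i _ => integrable_finsetSum _ fun j _ =>
        ((hi i j).const_mul _).mul_const _]
      refine Finset.sum_congr rfl fun i _ => ?_
      rw [integral_finsetSum _ fun j _ => ((hi i j).const_mul _).mul_const _]
      exact Finset.sum_congr rfl fun j _ => by rw [integral_mul_const, integral_const_mul]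
    rw [this]
    have hpos := hK.mono fun s hs => sum_pos hs ht hc
    have h0 : 0 ≤ᵐ[μ] fun s => ∑ i ∈ t, ∑ j ∈ t, c i * K s i j * c j := hpos.mono fun s hs => hs.le
    refine (integral_nonneg_of_ae h0).lt_of_ne fun h => ?_
    have h1 := (integral_eq_zero_iff_of_nonneg_ae h0 hint).1 h.symm
    have : NeZero μ := ⟨hμ⟩
    obtain ⟨s, hs, hs'⟩ := (hpos.and h1).exists
    exact hs.ne' hs'

lemma hasSum_quadratic_exp (k : X → X → ℝ) (s : Finset X) (c : X → ℝ) :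
    HasSum (fun n : ℕ => (n.factorial : ℝ)⁻¹ * ∑ i ∈ s, ∑ j ∈ s, c i * k i j ^ n * c j)
      (∑ i ∈ s, ∑ j ∈ s, c i * Real.exp (k i j) * c j) := by
  simp_rw [Finset.mul_sum]
  refine hasSum_sum fun i _ => hasSum_sum fun j _ => ?_
  have h := NormedSpace.expSeries_div_hasSum_exp (k i j)
  rw [← Real.exp_eq_exp_ℝ] at h
  convert! (h.mul_left (c i)).mul_right (c j) using 2
  ring

/-- If all power moments of a finitely supported signed measure vanish, so do its atoms. -/
lemma sum_filter_eq_zero_of_moments {ι : Type*} (s : Finset ι) (a g : ι → ℝ)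
    (h : ∀ n : ℕ, ∑ j ∈ s, g j ^ n * a j = 0) (v : ℝ) :
    ∑ j ∈ s with g j = v, a j = 0 := by
  classical
  have hp : ∀ p : Polynomial ℝ, ∑ j ∈ s, p.eval (g j) * a j = 0 := fun p => by
    simp_rw [Polynomial.eval_eq_sum_range, Finset.sum_mul]
    rw [Finset.sum_comm]
    refine Finset.sum_eq_zero fun n _ => ?_
    simp_rw [mul_assoc, ← Finset.mul_sum, h n, mul_zero]
  -- The Lagrange basis polynomial at `v`: it equals 1 at `v` and 0 at every other value of `g` on
  -- `s`.
  have := hp (∏ w ∈ (s.image g).erase v, Polynomial.C (v - w)⁻¹ *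
    (Polynomial.X - Polynomial.C w))
  rw [Finset.sum_filter]
  refine Eq.trans (Finset.sum_congr rfl fun j hj => ?_) this
  rw [Polynomial.eval_prod]
  simp only [Polynomial.eval_mul, Polynomial.eval_C, Polynomial.eval_sub, Polynomial.eval_X]
  split_ifs with hjv
  · rw [Finset.prod_eq_one, one_mul]
    intro w hw
    rw [hjv, inv_mul_cancel₀]
    exact sub_ne_zero.2 (Finset.ne_of_mem_erase hw).symm
  · rw [Finset.prod_eq_zero (i := g j) ?_ ?_, zero_mul]
    · exact Finset.mem_erase.2 ⟨hjv, Finset.mem_image_of_mem g hj⟩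
    · simp

/-- The quadratic form of `exp k` is a series of quadratic forms of Hadamard powers of `k`, each
nonnegative by Schur's product theorem. If the sum vanished, the coefficient vector would lie in the
kernel of every Hadamard power, so all moments of `c` along each row `k i` would vanish, and with
them the atoms. In the row with the largest diagonal entry, separation isolates the atom at `k i i`,
which is `c i`. -/
lemma posDef_exp {k : X → X → ℝ} (hk : (Matrix.of k).PosSemidef)
    (hsep : ∀ x y, x ≠ y → 2 * k x y < k x x + k y y) :
    (Matrix.of fun x y => Real.exp (k x y)).PosDef := by
  refine posDef_of_sum (fun x y => by rw [symm_of_posSemidef hk]) fun s c hs hc => ?_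
  have hsum := hasSum_quadratic_exp k s c
  have hnn : ∀ n : ℕ, 0 ≤ (n.factorial : ℝ)⁻¹ * ∑ i ∈ s, ∑ j ∈ s, c i * k i j ^ n * c j := fun n =>
      mul_nonneg (by positivity) (sum_nonneg (posSemidef_pow hk n) s c)
  refine (hsum.nonneg hnn).lt_of_ne fun h0 => ?_
  rw [← h0] at hsum
  have hz := (hasSum_zero_iff_of_nonneg hnn).1 hsum
  have hq : ∀ n : ℕ, ∑ i ∈ s, ∑ j ∈ s, c i * k i j ^ n * c j = 0 := fun n =>
    (mul_eq_zero.1 (congrFun hz n)).resolve_left (by positivity)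
  -- A vector on which a positive semidefinite form vanishes is in the kernel of its matrix.
  have hker : ∀ i ∈ s, ∀ n : ℕ, ∑ j ∈ s, k i j ^ n * c j = 0 := fun i hi n => by
    have hM := (posSemidef_pow hk n).submatrix ((↑) : s → X)
    have h1 := (hM.dotProduct_mulVec_zero_iff fun i => c i).1 (by
      simp only [dotProduct, Matrix.mulVec, Matrix.submatrix_apply, Matrix.of_apply, star_trivial,
        Pi.star_apply, Finset.mul_sum]
      rw [← hq n, ← Finset.sum_coe_sort s]
      simp_rw [← Finset.sum_coe_sort s fun j => c _ * k _ j ^ n * c j]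
      simp [mul_assoc])
    have h2 := congrFun h1 ⟨i, hi⟩
    simp only [Matrix.mulVec, dotProduct, Matrix.submatrix_apply, Matrix.of_apply,
      Pi.zero_apply] at h2
    rwa [Finset.sum_coe_sort s fun j => k i j ^ n * c j] at h2
  obtain ⟨i, hi, hmax⟩ := Finset.exists_max_image s (fun i => k i i) hs
  have h1 := sum_filter_eq_zero_of_moments s c (k i) (hker i hi) (k i i)
  have h2 : s.filter (fun j => k i j = k i i) = {i} := by
    ext j
    simp only [Finset.mem_filter, Finset.mem_singleton]
    -- For `j ≠ i`, `2 * k i j < k i i + k j j ≤ 2 * k i i` by maximality, so `k i j` differs from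
    -- `k i i`.
    refine ⟨fun ⟨hj, hij⟩ => ?_, fun h => by subst h; exact ⟨hi, rfl⟩⟩
    by_contra hne
    have := hsep i j (Ne.symm hne)
    have := hmax j hj
    linarith
  rw [h2, Finset.sum_singleton] at h1
  exact hc i hi h1

/-- Conditionally negative definite kernels. -/
def IsCND (ψ : X → X → ℝ) : Prop :=
  (∀ x y, ψ x y = ψ y x) ∧
    ∀ z, (Matrix.of fun x y => ψ x z + ψ z y - ψ x y - ψ z z).PosSemidef

lemma IsCND.congr {φ ψ : X → X → ℝ} (hψ : IsCND ψ) (h : ∀ x y, φ x y = ψ x y) : IsCND φ := by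
  obtain rfl : φ = ψ := funext₂ h
  exact hψ

lemma IsCND.of_posSemidef {k : X → X → ℝ} (hk : (Matrix.of k).PosSemidef) :
    IsCND fun x y => -k x y :=
  ⟨fun x y => congrArg _ (symm_of_posSemidef hk x y), fun z =>
    posSemidef_congr (posSemidef_shift hk z) fun x y => by ring⟩

lemma IsCND.add {φ ψ : X → X → ℝ} (h : IsCND φ) (h' : IsCND ψ) :
    IsCND fun x y => φ x y + ψ x y :=
  ⟨fun x y => congrArg₂ _ (h.1 x y) (h'.1 x y), fun z =>
    posSemidef_congr (posSemidef_add (h.2 z) (h'.2 z)) fun x y => by ring⟩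

lemma IsCND.separable (f : X → ℝ) : IsCND fun x y => f x + f y :=
  ⟨fun x y => add_comm _ _, fun z =>
    posSemidef_congr (posSemidef_rankOne fun _ : X => (0 : ℝ)) fun x y => by ring⟩

lemma IsCND.variogram {k : X → X → ℝ} (hk : (Matrix.of k).PosSemidef) :
    IsCND fun x y => k x x + k y y - 2 * k x y :=
  ((IsCND.separable fun x => k x x).add
    (IsCND.of_posSemidef (posSemidef_const_mul hk zero_le_two))).congr fun x y => by ring

lemma IsCND.const_mul {ψ : X → X → ℝ} (h : IsCND ψ) {a : ℝ} (ha : 0 ≤ a) :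
    IsCND fun x y => a * ψ x y :=
  ⟨fun x y => congrArg _ (h.1 x y), fun z =>
    posSemidef_congr (posSemidef_const_mul (h.2 z) ha) fun x y => by ring⟩

lemma IsCND.add_const {ψ : X → X → ℝ} (h : IsCND ψ) (a : ℝ) : IsCND fun x y => ψ x y + a :=
  (h.add (IsCND.separable fun _ : X => a / 2)).congr fun x y => by ring

lemma IsCND.comp {Y : Type*} {ψ : X → X → ℝ} (h : IsCND ψ) (f : Y → X) :
    IsCND fun x y => ψ (f x) (f y) :=
  ⟨fun _ _ => h.1 _ _, fun z => posSemidef_comp (h.2 (f z)) f⟩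

lemma IsCND.sum {ι : Type*} (s : Finset ι) {ψ : ι → X → X → ℝ} (h : ∀ i ∈ s, IsCND (ψ i)) :
    IsCND fun x y => ∑ i ∈ s, ψ i x y :=
  ⟨fun x y => Finset.sum_congr rfl fun i hi => (h i hi).1 x y, fun z =>
    posSemidef_congr (posSemidef_sum s (fun i hi => (h i hi).2 z)) fun x y => by
      simp [Finset.sum_add_distrib, Finset.sum_sub_distrib]⟩

lemma posDef_rankOne_mul {k : X → X → ℝ} (hk : (Matrix.of k).PosDef) {f : X → ℝ}
    (hf : ∀ x, f x ≠ 0) : (Matrix.of fun x y => f x * f y * k x y).PosDef :=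
  posDef_of_sum (fun x y => by rw [symm_of_posSemidef hk.posSemidef, mul_comm (f x)])
    fun s c hs hc => by
      have h := sum_pos hk hs (c := fun x => c x * f x) fun i hi => mul_ne_zero (hc i hi) (hf i)
      refine h.trans_eq (Finset.sum_congr rfl fun i _ => Finset.sum_congr rfl fun j _ => ?_)
      ring

lemma posDef_of_isEmpty [IsEmpty X] (k : X → X → ℝ) : (Matrix.of k).PosDef :=
  posDef_of_sum (fun x => isEmptyElim x) fun s c hs => by
    simp [Finset.eq_empty_of_isEmpty s] at hs

/-- Schoenberg: `exp (-ψ)` is positive definite if `ψ` is conditionally negative definite and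
separates points. -/
lemma IsCND.posDef_exp_neg {ψ : X → X → ℝ} (h : IsCND ψ)
    (hsep : ∀ x y, x ≠ y → ψ x x + ψ y y < 2 * ψ x y) :
    (Matrix.of fun x y => Real.exp (-ψ x y)).PosDef := by
  rcases isEmpty_or_nonempty X with hX | ⟨⟨z⟩⟩
  · exact posDef_of_isEmpty _
  -- With k(x, y) = ψ(x, z) + ψ(z, y) − ψ(x, y) − ψ(z, z), one has exp(−ψ(x, y)) = f(x) f(y) exp
  -- k(x, y), where f(x) = exp(ψ(z, z)/2 − ψ(x, z)) never vanishes.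
  · refine posDef_congr (posDef_rankOne_mul (posDef_exp (h.2 z) fun x y hxy => ?_)
      (f := fun x => Real.exp (ψ z z / 2 - ψ x z)) (fun x => (Real.exp_pos _).ne')) fun x y => ?_
    · have := hsep x y hxy
      have := h.1 x z
      have := h.1 y z
      linarith
    · rw [← Real.exp_add, ← Real.exp_add, h.1 z y]
      congr 1
      ring

end RadialKernel

/-! ### Power exponential, generalized Cauchy and Dagum profiles as mixtures of exponentials. -/

namespace RadialKernel

variable {X : Type u}

lemma restrict_Ioi_ne_zero : (volume.restrict (Ioi (0 : ℝ))) ≠ 0 := by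
  rw [Ne, Measure.restrict_eq_zero]
  simp

lemma ae_restrict_Ioi {p : ℝ → Prop} (h : ∀ s, 0 < s → p s) :
    ∀ᵐ s ∂(volume.restrict (Ioi (0 : ℝ))), p s :=
  ae_restrict_of_forall_mem measurableSet_Ioi h

lemma IsCND.integral {S : Type*} [MeasurableSpace S] {μ : Measure S} {K : S → X → X → ℝ}
    (hi : ∀ x y, Integrable (fun s => K s x y) μ) (hK : ∀ᵐ s ∂μ, IsCND (K s)) :
    IsCND fun x y => ∫ s, K s x y ∂μ :=
  ⟨fun x y => integral_congr_ae (hK.mono fun s hs => hs.1 x y), fun z => by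
    refine posSemidef_congr (posSemidef_integral
      (fun x y => (((hi x z).add (hi z y)).sub (hi x y)).sub (hi z z))
      (hK.mono fun s hs => hs.2 z)) fun x y => ?_
    have e1 := integral_sub (((hi x z).add (hi z y)).sub (hi x y)) (hi z z)
    have e2 := integral_sub ((hi x z).add (hi z y)) (hi x y)
    have e3 := integral_add (hi x z) (hi z y)
    simp only [Pi.add_apply, Pi.sub_apply] at e1 e2 e3 ⊢
    rw [e1, e2, e3]⟩

/-- Conditionally negative definite kernels with constant value `v ≥ 0` on the diagonal and larger
values off the diagonal. -/
structure IsShiftedVariogram (v : ℝ) (D : X → X → ℝ) : Prop where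
  cnd : IsCND D
  nonneg : 0 ≤ v
  diag : ∀ x, D x x = v
  lt : ∀ x y, x ≠ y → v < D x y

namespace IsShiftedVariogram

variable {v : ℝ} {D : X → X → ℝ}

lemma le (h : IsShiftedVariogram v D) (x y : X) : v ≤ D x y := by
  by_cases hxy : x = y
  · rw [hxy, h.diag]
  · exact (h.lt x y hxy).le

lemma apply_nonneg (h : IsShiftedVariogram v D) (x y : X) : 0 ≤ D x y := h.nonneg.trans (h.le x y)

lemma posDef_exp_neg (h : IsShiftedVariogram v D) :
    (Matrix.of fun x y => Real.exp (-D x y)).PosDef :=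
  h.cnd.posDef_exp_neg fun x y hxy => by
    have := h.lt x y hxy
    rw [h.diag, h.diag]
    linarith

lemma const_mul (h : IsShiftedVariogram v D) {a : ℝ} (ha : 0 < a) :
    IsShiftedVariogram (a * v) fun x y => a * D x y where
  cnd := h.cnd.const_mul ha.le
  nonneg := mul_nonneg ha.le h.nonneg
  diag x := by rw [h.diag]
  lt x y hxy := mul_lt_mul_of_pos_left (h.lt x y hxy) ha

/-- The reason for allowing a diagonal value `v`: a positive shift makes negative powers available,
and the shifted kernel can again be raised to powers in (0, 1]. -/
lemma add_const (h : IsShiftedVariogram v D) {a : ℝ} (ha : 0 ≤ a) :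
    IsShiftedVariogram (v + a) fun x y => D x y + a where
  cnd := h.cnd.add_const a
  nonneg := add_nonneg h.nonneg ha
  diag x := by rw [h.diag]
  lt x y hxy := by have := h.lt x y hxy; linarith

end IsShiftedVariogram

lemma integrableOn_gammaMixture {p b : ℝ} (hp : 0 < p) (hb : 0 < b) :
    IntegrableOn (fun t : ℝ => t ^ (p - 1) * Real.exp (-(b * t))) (Ioi 0) := by
  -- A non-integrable function would have integral 0, whereas the known value of this one is
  -- positive.
  refine Integrable.of_integral_ne_zero ?_
  rw [Real.integral_rpow_mul_exp_neg_mul_Ioi hp hb]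
  have := Real.Gamma_pos_of_pos hp
  positivity

/-- Negative powers of positive shifted variograms. -/
lemma IsShiftedVariogram.posDef_rpow_neg {v : ℝ} {D : X → X → ℝ} (h : IsShiftedVariogram v D)
    (hv : 0 < v) {p : ℝ} (hp : 0 < p) : (Matrix.of fun x y => D x y ^ (-p)).PosDef := by
  have hD : ∀ x y, 0 < D x y := fun x y => hv.trans_le (h.le x y)
  have hG := Real.Gamma_pos_of_pos hp
  -- The Gamma integral: D^(−p) = Γ(p)⁻¹ ∫ t^(p−1) exp(−D t) dt over t > 0.
  refine posDef_congr (posDef_const_mul (posDef_integral restrict_Ioi_ne_zero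
    (K := fun t x y => t ^ (p - 1) * Real.exp (-(D x y * t)))
    (fun x y => integrableOn_gammaMixture hp (hD x y))
    (ae_restrict_Ioi fun t ht => ?_)) (inv_pos.2 hG)) fun x y => ?_
  · refine posDef_const_mul (posDef_congr (h.const_mul ht).posDef_exp_neg fun x y => ?_)
      (Real.rpow_pos_of_pos ht _)
    rw [mul_comm]
  · rw [Real.integral_rpow_mul_exp_neg_mul_Ioi hp (hD x y), Real.rpow_neg (hD x y).le, one_div,
      Real.inv_rpow (hD x y).le]
    field_simp

/-- Powers with exponent in `(0, 1]` of shifted variograms. -/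
lemma IsShiftedVariogram.rpow {v : ℝ} {D : X → X → ℝ} (h : IsShiftedVariogram v D)
    {a : ℝ} (ha : 0 < a) (ha1 : a ≤ 1) : IsShiftedVariogram (v ^ a) fun x y => D x y ^ a where
  nonneg := Real.rpow_nonneg h.nonneg a
  diag x := by rw [h.diag]
  lt x y hxy := Real.rpow_lt_rpow h.nonneg (h.lt x y hxy) ha
  cnd := by
    rcases ha1.eq_or_lt with rfl | ha1
    · simpa using h.cnd
    have hmem : a ∈ Ioo (0 : ℝ) 1 := ⟨ha, ha1⟩
    -- For 0 < a < 1, D^a is a positive multiple of ∫ t^a (t⁻¹ − (t + D)⁻¹) dt. For each t the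
    -- integrand is a constant minus a positive semidefinite resolvent kernel.
    refine ((IsCND.integral (μ := volume.restrict (Ioi (0 : ℝ)))
      (K := fun t x y => a.rpowIntegrand₀₁ t (D x y))
      (fun x y => Real.integrableOn_rpowIntegrand₀₁_Ioi hmem (h.apply_nonneg x y))
      (ae_restrict_Ioi fun t ht => ?_)).const_mul
      (inv_pos.2 (Real.integral_rpowIntegrand₀₁_one_pos hmem)).le).congr fun x y =>
        Real.rpow_eq_const_mul_integral hmem (h.apply_nonneg x y)
    have h1 := ((h.add_const ht.le).posDef_rpow_neg (by have := h.nonneg; linarith)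
      one_pos).posSemidef
    refine ((IsCND.of_posSemidef (posSemidef_const_mul h1 (Real.rpow_pos_of_pos ht a).le)).add_const
      (t ^ a * t⁻¹)).congr fun x y => ?_
    rw [Real.rpowIntegrand₀₁, Real.rpow_neg_one, add_comm t]
    ring

lemma posDef_powerExponential {d : X → X → ℝ} (h : IsShiftedVariogram 0 d) {α β : ℝ}
    (hα : 0 < α) (hα1 : α ≤ 1) (hβ : 0 < β) :
    (Matrix.of fun x y => Real.exp (-β * d x y ^ α)).PosDef :=
  posDef_congr ((h.rpow hα hα1).const_mul hβ).posDef_exp_neg fun x y => by rw [neg_mul]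

lemma posDef_generalizedCauchy {d : X → X → ℝ} (h : IsShiftedVariogram 0 d) {α β ξ : ℝ}
    (hα : 0 < α) (hα1 : α ≤ 1) (hβ : 0 < β) (hξ : 0 < ξ) :
    (Matrix.of fun x y => (β * d x y ^ α + 1) ^ (-ξ / α)).PosDef := by
  have h1 := ((h.rpow hα hα1).const_mul hβ).add_const zero_le_one
  refine posDef_congr (h1.posDef_rpow_neg ?_ (div_pos hξ hα)) fun x y => by rw [neg_div]
  rw [Real.zero_rpow hα.ne']
  norm_num

/-- The Dagum kernel for small exponents. -/
lemma posDef_dagum_of_lt_one {D : X → X → ℝ} (h : IsShiftedVariogram 0 D) {γ : ℝ}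
    (hγ : 0 < γ) (hγ1 : γ < 1) :
    (Matrix.of fun x y => 1 - (D x y / (1 + D x y)) ^ γ).PosDef := by
  have hmem : γ ∈ Ioo (0 : ℝ) 1 := ⟨hγ, hγ1⟩
  have hD : ∀ x y, 0 ≤ D x y := h.apply_nonneg
  have hf : ∀ x y, 0 ≤ D x y / (1 + D x y) := fun x y =>
    div_nonneg (hD x y) (add_nonneg zero_le_one (hD x y))
  have i1 := Real.integrableOn_rpowIntegrand₀₁_Ioi hmem zero_le_one
  have i2 := fun x y => Real.integrableOn_rpowIntegrand₀₁_Ioi hmem (hf x y)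
  -- Both 1 = 1^γ and (D/(1+D))^γ are written with the resolvent integral. The difference of the
  -- integrands simplifies to t^γ (t+1)⁻² (D + t/(t+1))⁻¹, a negative power of a shifted variogram.
  refine posDef_congr (posDef_const_mul (posDef_integral restrict_Ioi_ne_zero
    (K := fun t x y => γ.rpowIntegrand₀₁ t 1 - γ.rpowIntegrand₀₁ t (D x y / (1 + D x y)))
    (fun x y => i1.sub (i2 x y)) (ae_restrict_Ioi fun t ht => ?_))
    (inv_pos.2 (Real.integral_rpowIntegrand₀₁_one_pos hmem))) fun x y => ?_
  · have ht1 : 0 < t / (t + 1) := by positivity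
    refine posDef_congr (posDef_const_mul ((h.add_const ht1.le).posDef_rpow_neg (by simpa using ht1)
      one_pos) (a := t ^ γ * ((t + 1) ^ 2)⁻¹) (by positivity)) fun x y => ?_
    have := hD x y
    simp only [Real.rpowIntegrand₀₁, Real.rpow_neg_one]
    have h1 : t + D x y / (1 + D x y) = (t + t * D x y + D x y) / (1 + D x y) := by
      field_simp
    have h2 : D x y + t / (t + 1) = (t + t * D x y + D x y) / (t + 1) := by
      field_simp
      ring
    have h3 : 0 < t + t * D x y + D x y := by positivity
    rw [h1, h2]
    field_simp
    ring
  · rw [integral_sub i1 (i2 x y), mul_sub, ← Real.rpow_eq_const_mul_integral hmem zero_le_one,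
      ← Real.rpow_eq_const_mul_integral hmem (hf x y), Real.one_rpow]

lemma continuous_exp_neg_rpow {a : ℝ} (ha : 0 < a) :
    Continuous fun v : ℝ => Real.exp (-v ^ a) :=
  Real.continuous_exp.comp (Real.continuous_rpow_const ha.le).neg

lemma integrableOn_exp_neg_rpow {a : ℝ} (ha : 0 < a) :
    IntegrableOn (fun v : ℝ => Real.exp (-v ^ a)) (Ioi 0) := by
  simpa using integrableOn_rpow_mul_exp_neg_rpow (s := 0) (by norm_num) ha

/-- The tail `∫ w in (z, ∞), exp (-w ^ a)` as a function of `z ≥ 0`. -/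
def expRpowTail (a z : ℝ) : ℝ := Real.Gamma (1 / a + 1) - ∫ w in (0 : ℝ)..z, Real.exp (-w ^ a)

lemma hasDerivAt_expRpowTail {a : ℝ} (ha : 0 < a) (z : ℝ) :
    HasDerivAt (expRpowTail a) (-Real.exp (-z ^ a)) z :=
  (((continuous_exp_neg_rpow ha).integral_hasStrictDerivAt 0
    z).hasDerivAt).const_sub (Real.Gamma (1 / a + 1))

lemma tendsto_expRpowTail {a : ℝ} (ha : 0 < a) : Tendsto (expRpowTail a) atTop (𝓝 0) := by
  have := (intervalIntegral_tendsto_integral_Ioi 0 (integrableOn_exp_neg_rpow ha)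
    tendsto_id).const_sub (Real.Gamma (1 / a + 1))
  rwa [integral_exp_neg_rpow ha, sub_self] at this

lemma integrableOn_exp_neg_add_rpow {a : ℝ} (ha : 0 < a) (z : ℝ) :
    IntegrableOn (fun v : ℝ => Real.exp (-(z + v) ^ a)) (Ioi 0) := by
  refine integrableOn_Ioi_deriv_of_nonneg' (g := fun v => -expRpowTail a (z + v)) (l := -0)
    (fun v _ => ?_) (fun v _ => (Real.exp_pos _).le)
    ((tendsto_expRpowTail ha).comp (tendsto_atTop_add_const_left _ z tendsto_id)).neg
  convert! ((hasDerivAt_expRpowTail ha (z + v)).comp_const_add z v).neg using 1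
  rw [neg_neg]

lemma integral_exp_neg_add_rpow {a : ℝ} (ha : 0 < a) (z : ℝ) :
    ∫ v in Ioi (0 : ℝ), Real.exp (-(z + v) ^ a) = expRpowTail a z := by
  rw [integral_Ioi_of_hasDerivAt_of_nonneg' (g := fun v => -expRpowTail a (z + v)) (l := -0)
    (fun v _ => ?_) (fun v _ => (Real.exp_pos _).le)
    ((tendsto_expRpowTail ha).comp (tendsto_atTop_add_const_left _ z tendsto_id)).neg]
  · simp
  · convert! ((hasDerivAt_expRpowTail ha (z + v)).comp_const_add z v).neg using 1
    rw [neg_neg]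

lemma expRpowTail_nonneg {a : ℝ} (ha : 0 < a) (z : ℝ) : 0 ≤ expRpowTail a z := by
  rw [← integral_exp_neg_add_rpow ha]
  exact integral_nonneg fun v => (Real.exp_pos _).le

lemma expRpowTail_le {a : ℝ} {z : ℝ} (hz : 0 ≤ z) :
    expRpowTail a z ≤ Real.Gamma (1 / a + 1) :=
  sub_le_self _ (intervalIntegral.integral_nonneg hz fun _ _ => (Real.exp_pos _).le)

/-- Integration by parts. The function g(y) = −exp(−y^a) · tail(y t) has as derivative the integrand
plus t · exp(−(1 + t^a) y^a); it runs from −Γ(1/a + 1) to 0, and the second term has a known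
integral. Normalized, the integral is the probability that W > t Y for independent Y with density a
y^(a−1) exp(−y^a) and W with density proportional to exp(−w^a). -/
lemma integral_expRpowTail_aux {a t : ℝ} (ha : 0 < a) (ht : 0 ≤ t) :
    IntegrableOn (fun y : ℝ => a * y ^ (a - 1) * Real.exp (-y ^ a) * expRpowTail a (y * t))
      (Ioi 0) ∧
    ∫ y in Ioi (0 : ℝ), a * y ^ (a - 1) * Real.exp (-y ^ a) * expRpowTail a (y * t)
      = Real.Gamma (1 / a + 1) * (1 - t * (1 + t ^ a) ^ (-1 / a)) := by
  have hb : 0 < 1 + t ^ a := by positivity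
  have hint : ∫ y in Ioi (0 : ℝ), t * Real.exp (-(1 + t ^ a) * y ^ a)
      = t * ((1 + t ^ a) ^ (-1 / a) * Real.Gamma (1 / a + 1)) := by
    rw [integral_const_mul, integral_exp_neg_mul_rpow ha hb]
  have i2 : IntegrableOn (fun y : ℝ => t * Real.exp (-(1 + t ^ a) * y ^ a)) (Ioi 0) := by
    have := integrableOn_rpow_mul_exp_neg_mul_rpow (s := 0) (by norm_num) ha hb
    simp only [Real.rpow_zero, one_mul] at this
    exact this.const_mul t
  set g : ℝ → ℝ := fun y => -(Real.exp (-y ^ a) * expRpowTail a (y * t)) with hg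
  have hT : Continuous (expRpowTail a) :=
    continuous_iff_continuousAt.2 fun z => (hasDerivAt_expRpowTail ha z).continuousAt
  have hcont : ContinuousWithinAt g (Ici 0) 0 :=
    (((continuous_exp_neg_rpow ha).mul (hT.comp (continuous_id.mul continuous_const))).neg
      ).continuousWithinAt
  have hderiv : ∀ y ∈ Ioi (0 : ℝ), HasDerivAt g
      (a * y ^ (a - 1) * Real.exp (-y ^ a) * expRpowTail a (y * t)
        + t * Real.exp (-(1 + t ^ a) * y ^ a)) y := fun y hy => by
    have h1 : HasDerivAt (fun y : ℝ => Real.exp (-y ^ a))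
        (Real.exp (-y ^ a) * -(a * y ^ (a - 1))) y :=
      ((Real.hasDerivAt_rpow_const (Or.inl (ne_of_gt hy))).neg).exp
    have h2 : HasDerivAt (fun y : ℝ => expRpowTail a (y * t)) (-Real.exp (-(y * t) ^ a) * t) y := by
      have := (hasDerivAt_expRpowTail ha (y * t)).comp y ((hasDerivAt_id y).mul_const t)
      rwa [one_mul] at this
    convert! (h1.mul h2).neg using 1
    have : Real.exp (-(1 + t ^ a) * y ^ a) = Real.exp (-y ^ a) * Real.exp (-(y * t) ^ a) := by
      rw [← Real.exp_add, Real.mul_rpow (le_of_lt hy) ht]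
      congr 1
      ring
    rw [this]
    ring
  -- Nonnegativity of the derivative, together with the limit of `g`, yields its integrability.
  have hpos : ∀ y ∈ Ioi (0 : ℝ), 0 ≤ a * y ^ (a - 1) * Real.exp (-y ^ a) * expRpowTail a (y * t)
        + t * Real.exp (-(1 + t ^ a) * y ^ a) := fun y hy => by
    have := expRpowTail_nonneg ha (y * t)
    have : 0 < y := hy
    positivity
  have hlim : Tendsto g atTop (𝓝 0) := by
    have h1 : Tendsto (fun y : ℝ => Real.exp (-y ^ a)) atTop (𝓝 0) :=
      Real.tendsto_exp_neg_atTop_nhds_zero.comp (tendsto_rpow_atTop ha)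
    have h2 := h1.mul_const (-Real.Gamma (1 / a + 1))
    rw [zero_mul] at h2
    refine tendsto_of_tendsto_of_tendsto_of_le_of_le' h2 tendsto_const_nhds ?_ ?_
    · filter_upwards [eventually_ge_atTop 0] with y hy
      rw [hg, mul_neg]
      exact neg_le_neg (mul_le_mul_of_nonneg_left (expRpowTail_le (mul_nonneg hy ht))
        (Real.exp_pos _).le)
    · exact Eventually.of_forall fun y => neg_nonpos.2
        (mul_nonneg (Real.exp_pos _).le (expRpowTail_nonneg ha _))
  have i3 := integrableOn_Ioi_deriv_of_nonneg hcont hderiv hpos hlim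
  have e3 := integral_Ioi_of_hasDerivAt_of_nonneg hcont hderiv hpos hlim
  have i1 : IntegrableOn (fun y : ℝ => a * y ^ (a - 1) * Real.exp (-y ^ a) *
      expRpowTail a (y * t)) (Ioi 0) := by
    refine (i3.sub i2).congr_fun (fun y _ => ?_) measurableSet_Ioi
    simp
  refine ⟨i1, ?_⟩
  rw [integral_add i1 i2, hint] at e3
  have : g 0 = -Real.Gamma (1 / a + 1) := by
    simp [hg, expRpowTail, Real.zero_rpow ha.ne']
  rw [this] at e3
  linear_combination e3

/-- The Dagum kernel for large exponents. -/
lemma posDef_dagum_aux {T : X → X → ℝ} (h : IsShiftedVariogram 0 T) {a : ℝ}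
    (ha : 0 < a) (ha1 : a ≤ 1) :
    (Matrix.of fun x y => 1 - T x y * (1 + T x y ^ a) ^ (-1 / a)).PosDef := by
  have hG : 0 < Real.Gamma (1 / a + 1) := Real.Gamma_pos_of_pos (by positivity)
  refine posDef_congr (posDef_const_mul (posDef_integral restrict_Ioi_ne_zero
    (K := fun s x y => a * s ^ (a - 1) * Real.exp (-s ^ a) * expRpowTail a (s * T x y))
    (fun x y => (integral_expRpowTail_aux ha (h.apply_nonneg x y)).1)
    (ae_restrict_Ioi fun s hs => ?_)) (inv_pos.2 hG)) fun x y => ?_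
  -- The tail at s T is itself the mixture over v > 0 of exp(−(s T + v)^a), and (s T + v)^a is a
  -- shifted variogram as a ≤ 1.
  · refine posDef_const_mul (posDef_congr (posDef_integral restrict_Ioi_ne_zero
      (K := fun v x y => Real.exp (-(s * T x y + v) ^ a))
      (fun x y => integrableOn_exp_neg_add_rpow ha _) (ae_restrict_Ioi fun v hv => ?_)) fun x y =>
        (integral_exp_neg_add_rpow ha _).symm) (by positivity)
    exact (((h.const_mul hs).add_const hv.le).rpow ha ha1).posDef_exp_neg
  · rw [(integral_expRpowTail_aux ha (h.apply_nonneg x y)).2]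
    field_simp

/-- The exponent ξ/α decides. Below 1, the resolvent integral applies to β d^α. Otherwise put T =
β^(ξ/α) d^ξ, a variogram since ξ ≤ 1, and a = α/ξ ≤ 1. Then T^a = β d^α and the kernel becomes 1 − T
(1 + T^a)^(−1/a). -/
lemma posDef_dagum {d : X → X → ℝ} (h : IsShiftedVariogram 0 d) {α β ξ : ℝ}
    (hα : 0 < α) (hα1 : α ≤ 1) (hβ : 0 < β) (hξ : 0 < ξ) (hξ1 : ξ ≤ 1) :
    (Matrix.of fun x y => 1 - (β * d x y ^ α / (1 + β * d x y ^ α)) ^ (ξ / α)).PosDef := by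
  rcases lt_or_ge (ξ / α) 1 with h1 | h1
  · have h2 := (h.rpow hα hα1).const_mul hβ
    rw [Real.zero_rpow hα.ne', mul_zero] at h2
    exact posDef_dagum_of_lt_one h2 (div_pos hξ hα) h1
  · have hβ' : 0 < β ^ (ξ / α) := by positivity
    have h2 := (h.rpow hξ hξ1).const_mul hβ'
    rw [Real.zero_rpow hξ.ne', mul_zero] at h2
    refine posDef_congr (posDef_dagum_aux h2 (a := α / ξ) (div_pos hα hξ)
      ((div_le_one hξ).2 ((one_le_div hα).1 h1))) fun x y => ?_
    have hd := h.apply_nonneg x y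
    have e1 : (β ^ (ξ / α) * d x y ^ ξ) ^ (α / ξ) = β * d x y ^ α := by
      rw [Real.mul_rpow hβ'.le (by positivity), ← Real.rpow_mul hβ.le, ← Real.rpow_mul hd]
      have : ξ / α * (α / ξ) = 1 := by field_simp
      rw [this, Real.rpow_one]
      congr 2
      field_simp
    have e2 : (β * d x y ^ α) ^ (ξ / α) = β ^ (ξ / α) * d x y ^ ξ := by
      rw [Real.mul_rpow hβ.le (by positivity), ← Real.rpow_mul hd]
      congr 2
      field_simp
    have hpos : 0 ≤ 1 + β * d x y ^ α := by positivity
    rw [e1, Real.div_rpow (by positivity) hpos, e2, div_eq_mul_inv, ← Real.rpow_neg hpos]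
    congr 3
    field_simp

end RadialKernel

/-! ### Matérn profiles as mixtures of exponentials. -/

namespace RadialKernel

variable {X : Type u}

/-- Tonelli for nonnegative functions, in terms of Bochner integrals. -/
lemma integral_swap_of_nonneg {S R : Type*} [MeasurableSpace S] [MeasurableSpace R]
    {μ : Measure S} {ν : Measure R} [SFinite μ] [SFinite ν] {f : S → R → ℝ}
    (hm : Measurable (Function.uncurry f)) (h0 : ∀ s, ∀ᵐ r ∂ν, 0 ≤ f s r)
    (h1 : ∀ᵐ s ∂μ, Integrable (f s) ν) (h2 : Integrable (fun s => ∫ r, f s r ∂ν) μ) :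
    Integrable (fun r => ∫ s, f s r ∂μ) ν ∧
      ∫ s, ∫ r, f s r ∂ν ∂μ = ∫ r, ∫ s, f s r ∂μ ∂ν := by
  have hint : Integrable (Function.uncurry f) (μ.prod ν) := by
    rw [integrable_prod_iff hm.aestronglyMeasurable]
    refine ⟨h1, h2.congr (Eventually.of_forall fun s => ?_)⟩
    refine integral_congr_ae ((h0 s).mono fun r hr => ?_)
    simp [abs_of_nonneg hr]
  exact ⟨hint.integral_prod_right, integral_integral_swap hint⟩

lemma sq_div_four_le_cosh (s : ℝ) : s ^ 2 / 4 ≤ Real.cosh s := by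
  have h := Real.quadratic_le_exp_of_nonneg (abs_nonneg s)
  have h2 : Real.exp |s| / 2 ≤ Real.cosh s := by
    rw [← Real.cosh_abs, Real.cosh_eq]
    have := Real.exp_pos (-|s|)
    linarith
  have := sq_abs s
  have := abs_nonneg s
  linarith

/-- Gaussian domination: cosh s ≥ s²/4 gives decay exp(−x s²/4), half of which absorbs the linear
term a s after completing the square. -/
lemma integrable_exp_cosh {x : ℝ} (hx : 0 < x) (a : ℝ) :
    Integrable fun s : ℝ => Real.exp (-x * Real.cosh s + a * s) := by
  refine ((integrable_exp_neg_mul_sq (b := x / 8) (by positivity)).const_mul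
    (Real.exp (2 * a ^ 2 / x))).mono' (by fun_prop) (Eventually.of_forall fun s => ?_)
  rw [Real.norm_eq_abs, Real.abs_exp, ← Real.exp_add]
  refine Real.exp_le_exp.2 ?_
  have h1 := mul_le_mul_of_nonneg_left (sq_div_four_le_cosh s) hx.le
  have h2 : a * s ≤ 2 * a ^ 2 / x + x / 8 * s ^ 2 := by
    have : 2 * a ^ 2 / x + x / 8 * s ^ 2 - a * s = 2 / x * (a - x * s / 4) ^ 2 := by
      field_simp
      ring
    have h3 : 0 ≤ 2 / x * (a - x * s / 4) ^ 2 := by positivity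
    linarith
  linarith

lemma integral_exp_cosh_eq_integral_cosh {x : ℝ} (hx : 0 < x) (a : ℝ) :
    ∫ s : ℝ, Real.exp (-x * Real.cosh s + a * s)
      = ∫ s : ℝ, Real.exp (-x * Real.cosh s) * Real.cosh (a * s) := by
  have i1 := integrable_exp_cosh hx a
  have i2 := integrable_exp_cosh hx (-a)
  have h : ∫ s : ℝ, Real.exp (-x * Real.cosh s + a * s)
      = ∫ s : ℝ, Real.exp (-x * Real.cosh s + -a * s) := by
    rw [← integral_neg_eq_self]
    refine integral_congr_ae (Eventually.of_forall fun s => ?_)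
    simp
  have h2 : ∫ s : ℝ, Real.exp (-x * Real.cosh s + a * s) =
      2⁻¹ * ∫ s : ℝ, Real.exp (-x * Real.cosh s + a * s) + Real.exp (-x * Real.cosh s + -a * s) := by
    rw [integral_add i1 i2, ← h]
    ring
  rw [h2, ← integral_const_mul]
  refine integral_congr_ae (Eventually.of_forall fun s => ?_)
  simp only [Real.exp_add, Real.cosh_eq (a * s), neg_mul a]
  ring

/-- Symmetrization in s trades cosh(a s) for exp(a s) on the whole line, where the variable can be
translated and exponents combine. -/
lemma integral_exp_cosh {x : ℝ} (hx : 0 < x) (a : ℝ) :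
    ∫ s : ℝ, Real.exp (-x * Real.cosh s + a * s) = 2 * besselK a x := by
  rw [integral_exp_cosh_eq_integral_cosh hx, besselK,
    ← integral_comp_abs (f := fun s => Real.exp (-x * Real.cosh s) * Real.cosh (a * s))]
  refine integral_congr_ae (Eventually.of_forall fun s => ?_)
  have : Real.cosh (a * |s|) = Real.cosh (a * s) := by
    rw [← Real.cosh_abs, ← Real.cosh_abs (a * s), abs_mul, abs_mul, abs_abs]
  simp [this]

/-- The substitution v = sinh(s/2), with cosh s = 1 + 2 v² and dv = cosh(s/2)/2 ds, leaves a
Gaussian integral. -/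
lemma integral_exp_cosh_half {x : ℝ} (hx : 0 < x) :
    ∫ s : ℝ, Real.exp (-x * Real.cosh s + 1 / 2 * s)
      = 2 * √(Real.pi / (2 * x)) * Real.exp (-x) := by
  rw [integral_exp_cosh_eq_integral_cosh hx, ← integral_gaussian]
  have himg : (fun s : ℝ => Real.sinh (1 / 2 * s)) '' univ = univ := by
    rw [image_univ, range_eq_univ]
    intro v
    obtain ⟨w, hw⟩ := Real.sinh_surjective v
    exact ⟨2 * w, by simp [hw]⟩
  have h := integral_image_eq_integral_abs_deriv_smul (s := univ)
    (f := fun s : ℝ => Real.sinh (1 / 2 * s)) (f' := fun s => Real.cosh (1 / 2 * s) * (1 / 2))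
    MeasurableSet.univ (fun s _ =>
      ((((hasDerivAt_id s).const_mul (1 / 2 : ℝ)).sinh).congr_deriv (by simp)).hasDerivWithinAt)
    (fun s _ t _ hst => by simpa using Real.sinh_injective hst)
    (fun v => Real.exp (-(2 * x) * v ^ 2))
  rw [himg, Measure.restrict_univ] at h
  rw [h, mul_assoc, ← integral_mul_const, ← integral_const_mul]
  refine integral_congr_ae (Eventually.of_forall fun s => ?_)
  have hc : Real.cosh s = 1 + 2 * Real.sinh (1 / 2 * s) ^ 2 := by
    have h1 := Real.cosh_two_mul (1 / 2 * s)
    have h2 := Real.cosh_sq (1 / 2 * s)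
    have h3 : 2 * (1 / 2 * s) = s := by ring
    rw [h3] at h1
    linarith
  have hp := Real.cosh_pos (1 / 2 * s)
  simp only [smul_eq_mul]
  rw [abs_of_pos (by positivity), hc, show -x * (1 + 2 * Real.sinh (1 / 2 * s) ^ 2)
    = -x + -(2 * x) * Real.sinh (1 / 2 * s) ^ 2 by ring, Real.exp_add]
  ring

lemma besselK_half {x : ℝ} (hx : 0 < x) :
    besselK (1 / 2) x = √(Real.pi / (2 * x)) * Real.exp (-x) := by
  have := integral_exp_cosh hx (1 / 2)
  rw [integral_exp_cosh_half hx] at this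
  linarith

/-- The mixing density in the representation of Matérn functions by exponentials. -/
def maternIntegrand (δ x r : ℝ) : ℝ :=
  r ^ (δ - 1) * ((1 + r) ^ (-(1 / 2) : ℝ) * Real.exp (-(x * √(1 + r))))

/-- The extra term is absorbed by a translation: x cosh s + r (x/2) eˢ = x √(1+r) cosh(s + l) with l
= log(1+r)/2, which reduces to `integral_exp_cosh_half`. -/
lemma integral_exp_cosh_add {x r : ℝ} (hx : 0 < x) (hr : 0 < r) :
    ∫ s : ℝ, Real.exp (-x * Real.cosh s - r * (x / 2) * Real.exp s + 1 / 2 * s)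
      = 2 * √(Real.pi / (2 * x)) * ((1 + r) ^ (-(1 / 2) : ℝ) * Real.exp (-(x * √(1 + r)))) := by
  have hr1 : 0 < 1 + r := by positivity
  set l := Real.log (1 + r) / 2 with hl
  have hel : Real.exp l = √(1 + r) := by
    rw [hl, Real.exp_half, Real.exp_log hr1]
  have hq : 0 < √(1 + r) := Real.sqrt_pos.2 hr1
  have hqq : √(1 + r) * √(1 + r) = 1 + r := Real.mul_self_sqrt hr1.le
  rw [← integral_sub_right_eq_self _ l]
  have e1 : ∀ s : ℝ, Real.exp (-x * Real.cosh (s - l) - r * (x / 2) * Real.exp (s - l)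
      + 1 / 2 * (s - l)) = Real.exp (-(l / 2)) *
        Real.exp (-(x * √(1 + r)) * Real.cosh s + 1 / 2 * s) := fun s => by
    rw [← Real.exp_add]
    congr 1
    rw [Real.cosh_eq, Real.cosh_eq, neg_sub, Real.exp_sub, Real.exp_sub, hel, Real.exp_neg]
    have := Real.exp_pos s
    field_simp
    linear_combination x * Real.exp s ^ 2 * hqq
  simp_rw [e1]
  rw [integral_const_mul, integral_exp_cosh_half (mul_pos hx hq)]
  have e2 : √(Real.pi / (2 * (x * √(1 + r)))) = √(Real.pi / (2 * x)) * Real.exp (-(l / 2)) := by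
    rw [← mul_assoc, ← div_div, Real.sqrt_div (by positivity), ← hel, ← Real.exp_half,
      Real.exp_neg, div_eq_mul_inv]
  have e3 : (1 + r) ^ (-(1 / 2) : ℝ) = Real.exp (-(l / 2)) * Real.exp (-(l / 2)) := by
    rw [← Real.exp_add, Real.rpow_def_of_pos hr1, hl]
    congr 1
    ring
  rw [e2, e3]
  ring

/-- A Beta integral, needed for the value of the profile at 0. It comes from integrating the double
integrand `f` over r and w in either order, each inner integral being a Gamma integral. -/
lemma integral_maternIntegrand_zero {α : ℝ} (hα : 0 < α) (hα1 : α < 1 / 2) :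
    IntegrableOn (maternIntegrand (1 / 2 - α) 0) (Ioi 0) ∧
      ∫ r in Ioi (0 : ℝ), maternIntegrand (1 / 2 - α) 0 r
        = Real.Gamma (1 / 2 - α) * Real.Gamma α / √Real.pi := by
  have hδ : 0 < 1 / 2 - α := by linarith
  have hπ : 0 < √Real.pi := Real.sqrt_pos.2 Real.pi_pos
  set f : ℝ → ℝ → ℝ := fun w r =>
    w ^ (1 / 2 - 1 : ℝ) * Real.exp (-w) * (r ^ (1 / 2 - α - 1) * Real.exp (-(w * r))) with hf
  have hr : ∀ w ∈ Ioi (0 : ℝ), ∫ r in Ioi (0 : ℝ), f w r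
      = Real.Gamma (1 / 2 - α) * (w ^ (α - 1) * Real.exp (-(1 * w))) := fun w hw => by
    have hw' : 0 < w := hw
    rw [hf, integral_const_mul, Real.integral_rpow_mul_exp_neg_mul_Ioi hδ hw, one_div w,
      Real.inv_rpow hw'.le, ← Real.rpow_neg hw'.le, show α - 1 = (1 / 2 - 1) + -(1 / 2 - α) by ring,
      Real.rpow_add hw', one_mul]
    ring
  have hw : ∀ r ∈ Ioi (0 : ℝ), ∫ w in Ioi (0 : ℝ), f w r
      = √Real.pi * maternIntegrand (1 / 2 - α) 0 r := fun r hr => by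
    have hr' : 0 < r := hr
    have : ∀ w, f w r = r ^ (1 / 2 - α - 1) * (w ^ (1 / 2 - 1 : ℝ) * Real.exp (-((1 + r) * w))) :=
      fun w => by
        rw [hf, add_mul, neg_add, Real.exp_add, mul_comm r w, one_mul]
        ring
    simp_rw [this]
    rw [integral_const_mul, Real.integral_rpow_mul_exp_neg_mul_Ioi one_half_pos (by positivity),
      Real.Gamma_one_half_eq, maternIntegrand, one_div (1 + r), Real.inv_rpow (by positivity),
      ← Real.rpow_neg (by positivity)]
    simp
    ring
  -- The absolute value secures nonnegativity off the positive half-lines too; on them it changes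
  -- nothing.
  obtain ⟨h1, h2⟩ := integral_swap_of_nonneg (μ := volume.restrict (Ioi (0 : ℝ)))
    (ν := volume.restrict (Ioi (0 : ℝ))) (f := fun w r => |f w r|) (by fun_prop)
    (fun w => Eventually.of_forall fun r => abs_nonneg _)
    (ae_restrict_Ioi fun w hw => ((integrableOn_gammaMixture hδ hw).const_mul _).abs)
    (((integrableOn_gammaMixture hα one_pos).const_mul (Real.Gamma (1 / 2 - α))).congr
      (ae_restrict_Ioi fun w hw => by
        refine (hr w hw).symm.trans ?_
        refine setIntegral_congr_fun measurableSet_Ioi fun r hr => ?_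
        have : 0 < r := hr
        exact (abs_of_nonneg (by positivity)).symm))
  have habs : ∀ w ∈ Ioi (0 : ℝ), ∀ r ∈ Ioi (0 : ℝ), |f w r| = f w r := fun w hw r hr => by
    have : 0 < r := hr
    have : 0 < w := hw
    exact abs_of_nonneg (by positivity)
  have e1 : ∫ w in Ioi (0 : ℝ), ∫ r in Ioi (0 : ℝ), |f w r|
      = Real.Gamma (1 / 2 - α) * Real.Gamma α := by
    rw [setIntegral_congr_fun measurableSet_Ioi fun w hw => by
      rw [setIntegral_congr_fun measurableSet_Ioi fun r hr => habs w hw r hr, hr w hw],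
      integral_const_mul, Real.integral_rpow_mul_exp_neg_mul_Ioi hα one_pos]
    simp
  have e2 : ∀ r ∈ Ioi (0 : ℝ), ∫ w in Ioi (0 : ℝ), |f w r|
      = √Real.pi * maternIntegrand (1 / 2 - α) 0 r := fun r hr => by
    rw [setIntegral_congr_fun measurableSet_Ioi fun w hw => habs w hw r hr, hw r hr]
  constructor
  · refine (h1.const_mul (√Real.pi)⁻¹).congr (ae_restrict_Ioi fun r hr => ?_)
    simp only
    rw [e2 r hr, inv_mul_cancel_left₀ hπ.ne']
  · rw [e1, setIntegral_congr_fun measurableSet_Ioi e2, integral_const_mul] at h2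
    rw [h2]
    field_simp

/-- Write exp(α s) = exp(s/2) exp(−(1/2−α) s) in the integral for K_α and expand the second factor
as a Gamma integral in r. After exchanging the integrals, the inner one over s is
`integral_exp_cosh_add`. -/
lemma integral_maternIntegrand {α x : ℝ} (hα1 : α < 1 / 2) (hx : 0 < x) :
    IntegrableOn (maternIntegrand (1 / 2 - α) x) (Ioi 0) ∧
      2 * √(Real.pi / (2 * x)) * ∫ r in Ioi (0 : ℝ), maternIntegrand (1 / 2 - α) x r
        = Real.Gamma (1 / 2 - α) * (x / 2) ^ (-(1 / 2 - α)) * (2 * besselK α x) := by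
  have hδ : 0 < 1 / 2 - α := by linarith
  have hπ : 0 < √(Real.pi / (2 * x)) := Real.sqrt_pos.2 (by positivity)
  set f : ℝ → ℝ → ℝ := fun s r => |r ^ (1 / 2 - α - 1)| *
    Real.exp (-x * Real.cosh s - r * (x / 2) * Real.exp s + 1 / 2 * s) with hf
  have hfe : ∀ s, ∀ r ∈ Ioi (0 : ℝ), f s r = Real.exp (-x * Real.cosh s + 1 / 2 * s) *
      (r ^ (1 / 2 - α - 1) * Real.exp (-((x / 2) * Real.exp s * r))) := fun s r hr => by
    have : 0 < r := hr
    simp only [hf]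
    rw [abs_of_nonneg (by positivity), mul_left_comm, ← Real.exp_add]
    congr 2
    ring
  have hr : ∀ s, ∫ r in Ioi (0 : ℝ), f s r = Real.Gamma (1 / 2 - α) * (x / 2) ^ (-(1 / 2 - α)) *
      Real.exp (-x * Real.cosh s + α * s) := fun s => by
    rw [setIntegral_congr_fun measurableSet_Ioi (hfe s), integral_const_mul,
      Real.integral_rpow_mul_exp_neg_mul_Ioi hδ (by positivity), one_div (x / 2 * _),
      Real.inv_rpow (by positivity), ← Real.rpow_neg (by positivity),
      Real.mul_rpow (by positivity) (Real.exp_pos s).le, ← Real.exp_mul]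
    have : Real.exp (-x * Real.cosh s + α * s) = Real.exp (-x * Real.cosh s + 1 / 2 * s) *
        Real.exp (s * -(1 / 2 - α)) := by
      rw [← Real.exp_add]
      congr 1
      ring
    rw [this]
    ring
  have hs : ∀ r ∈ Ioi (0 : ℝ), ∫ s, f s r
      = 2 * √(Real.pi / (2 * x)) * maternIntegrand (1 / 2 - α) x r := fun r hr => by
    have : 0 < r := hr
    simp only [hf]
    rw [integral_const_mul, integral_exp_cosh_add hx hr, abs_of_nonneg (by positivity),
      maternIntegrand]
    ring
  obtain ⟨h1, h2⟩ := integral_swap_of_nonneg (μ := volume)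
    (ν := volume.restrict (Ioi (0 : ℝ))) (f := f) (by fun_prop)
    (fun s => Eventually.of_forall fun r => by positivity)
    (Eventually.of_forall fun s =>
      ((integrableOn_gammaMixture hδ (b := x / 2 * Real.exp s) (by positivity)).const_mul
        (Real.exp (-x * Real.cosh s + 1 / 2 * s))).congr
        (ae_restrict_Ioi fun r hr => (hfe s r hr).symm))
    (((integrable_exp_cosh hx α).const_mul
      (Real.Gamma (1 / 2 - α) * (x / 2) ^ (-(1 / 2 - α)))).congr
      (Eventually.of_forall fun s => (hr s).symm))
  constructor
  · refine (h1.const_mul (2 * √(Real.pi / (2 * x)))⁻¹).congr (ae_restrict_Ioi fun r hr => ?_)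
    simp only
    rw [hs r hr, inv_mul_cancel_left₀ (by positivity)]
  · simp_rw [hr] at h2
    rw [setIntegral_congr_fun measurableSet_Ioi hs, integral_const_mul, integral_const_mul,
      integral_exp_cosh hx] at h2
    exact h2.symm

lemma matern_eq {α x : ℝ} (hα1 : α < 1 / 2) (hx : 0 < x) :
    x ^ α * besselK α x = 2 ^ (α - 1) * √Real.pi / Real.Gamma (1 / 2 - α) *
      ∫ r in Ioi (0 : ℝ), maternIntegrand (1 / 2 - α) x r := by
  have hG : 0 < Real.Gamma (1 / 2 - α) := Real.Gamma_pos_of_pos (by linarith)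
  have h := (integral_maternIntegrand hα1 hx).2
  have hsq : √(Real.pi / (2 * x)) = √Real.pi * (2 ^ (-(1 / 2) : ℝ) * x ^ (-(1 / 2) : ℝ)) := by
    rw [Real.sqrt_div' _ (by positivity), Real.sqrt_eq_rpow (2 * x), div_eq_mul_inv,
      ← Real.rpow_neg (by positivity), Real.mul_rpow zero_le_two hx.le]
  have hx2 : (x / 2) ^ (-(1 / 2 - α)) = x ^ α * x ^ (-(1 / 2) : ℝ) * 2 ^ (1 / 2 - α) := by
    rw [Real.div_rpow hx.le zero_le_two, div_eq_mul_inv, ← Real.rpow_neg zero_le_two, neg_neg,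
      ← Real.rpow_add hx]
    congr 2
    ring
  rw [hsq, hx2] at h
  have hxp : 0 < x ^ (-(1 / 2) : ℝ) := by positivity
  have h2p : (0 : ℝ) < 2 ^ (1 / 2 - α) := by positivity
  have h2 : (2 : ℝ) ^ (-(1 / 2) : ℝ) = 2 ^ (α - 1) * 2 ^ (1 / 2 - α) := by
    rw [← Real.rpow_add zero_lt_two]
    congr 1
    ring
  rw [h2] at h
  have h3 : Real.Gamma (1 / 2 - α) * (x ^ α * besselK α x) = 2 ^ (α - 1) * √Real.pi *
      ∫ r in Ioi (0 : ℝ), maternIntegrand (1 / 2 - α) x r := by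
    refine mul_left_cancel₀ (mul_pos (mul_pos hxp h2p) zero_lt_two).ne' ?_
    linear_combination -h
  rw [div_mul_eq_mul_div, ← h3, mul_div_cancel_left₀ _ hG.ne']

/-- At α = 1/2 the profile is a plain exponential. Below 1/2 it is a mixture over r of exp(−√(1+r) β
t), and the prescribed value at 0 is the value of the same mixture there. -/
lemma posDef_matern {d : X → X → ℝ} (h : IsShiftedVariogram 0 d) {C : ℝ → ℝ} (hC : IsMatern C) :
    (Matrix.of fun x y => C (d x y)).PosDef := by
  obtain ⟨α, β, hα, hα1, hβ, h0, hC⟩ := hC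
  have hd := h.apply_nonneg
  rcases hα1.eq_or_lt with rfl | hα1
  · have hCe : ∀ t, 0 ≤ t → C t = √(Real.pi / 2) * Real.exp (-(β * t)) := fun t ht => by
      rcases ht.eq_or_lt with rfl | ht
      · rw [h0, Real.Gamma_one_half_eq, show (1 / 2 - 1 : ℝ) = -(1 / 2) by norm_num,
          Real.rpow_neg zero_le_two, ← Real.sqrt_eq_rpow, Real.sqrt_div' _ zero_le_two]
        simp
        ring
      · have hx : 0 < β * t := mul_pos hβ ht
        rw [hC t ht, besselK_half hx, ← div_div, Real.sqrt_div' _ hx.le, ← Real.sqrt_eq_rpow]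
        have : 0 < √(β * t) := Real.sqrt_pos.2 hx
        field_simp
    exact posDef_congr (posDef_const_mul (h.const_mul hβ).posDef_exp_neg
      (Real.sqrt_pos.2 (by positivity))) fun x y => hCe _ (hd x y)
  · have hG : 0 < Real.Gamma (1 / 2 - α) := Real.Gamma_pos_of_pos (by linarith)
    have hCe : ∀ t, 0 ≤ t → IntegrableOn (maternIntegrand (1 / 2 - α) (β * t)) (Ioi 0) ∧
        C t = 2 ^ (α - 1) * √Real.pi / Real.Gamma (1 / 2 - α) *
          ∫ r in Ioi (0 : ℝ), maternIntegrand (1 / 2 - α) (β * t) r := fun t ht => by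
      rcases ht.eq_or_lt with rfl | ht
      · rw [mul_zero]
        refine ⟨(integral_maternIntegrand_zero hα hα1).1, ?_⟩
        rw [(integral_maternIntegrand_zero hα hα1).2, h0]
        have : 0 < √Real.pi := Real.sqrt_pos.2 Real.pi_pos
        generalize Real.Gamma (1 / 2 - α) = g at hG
        field_simp
      · have hx : 0 < β * t := mul_pos hβ ht
        exact ⟨(integral_maternIntegrand hα1 hx).1, by rw [hC t ht, matern_eq hα1 hx]⟩
    refine posDef_congr (posDef_const_mul (posDef_integral restrict_Ioi_ne_zero
      (K := fun r x y => maternIntegrand (1 / 2 - α) (β * d x y) r)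
      (fun x y => (hCe _ (hd x y)).1) (ae_restrict_Ioi fun r hr => ?_)) ?_)
      fun x y => (hCe _ (hd x y)).2
    · have hq : 0 < √(1 + r) * β := mul_pos (Real.sqrt_pos.2 (by positivity)) hβ
      refine posDef_congr (posDef_const_mul (h.const_mul hq).posDef_exp_neg
        (a := r ^ (1 / 2 - α - 1) * (1 + r) ^ (-(1 / 2) : ℝ)) (by positivity)) fun x y => ?_
      rw [maternIntegrand, show β * d x y * √(1 + r) = √(1 + r) * β * d x y by ring,
        mul_assoc (r ^ _)]
    · have : 0 < √Real.pi := Real.sqrt_pos.2 Real.pi_pos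
      positivity

/-- The radial profiles of a metric whose square root embeds into a Hilbert space. -/
theorem posDef_of_isRadialProfile {d : X → X → ℝ} (h : IsShiftedVariogram 0 d) {C : ℝ → ℝ}
    (hC : IsRadialProfile C) : (Matrix.of fun x y => C (d x y)).PosDef := by
  have hd := h.apply_nonneg
  rcases hC with ⟨α, β, hα, hα1, hβ, hC⟩ | hC | ⟨α, β, ξ, hα, hα1, hβ, hξ, hC⟩ |
    ⟨α, β, ξ, hα, hα1, hβ, hξ, hξ1, hC⟩
  · exact posDef_congr (posDef_powerExponential h hα hα1 hβ) fun x y => hC _ (hd x y)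
  · exact posDef_matern h hC
  · exact posDef_congr (posDef_generalizedCauchy h hα hα1 hβ hξ) fun x y => hC _ (hd x y)
  · exact posDef_congr (posDef_dagum h hα hα1 hβ hξ hξ1) fun x y => hC _ (hd x y)

end RadialKernel

/-! ### The resistance metric: Brownian bridges and the grounded Laplacian. -/

namespace RadialKernel

lemma integral_indicator_Iic_Ioc {s : ℝ} (hs : s ∈ Icc (0 : ℝ) 1) :
    Integrable ((Iic s).indicator fun _ => (1 : ℝ)) (volume.restrict (Ioc (0 : ℝ) 1)) ∧
      ∫ u in Ioc (0 : ℝ) 1, (Iic s).indicator (fun _ => (1 : ℝ)) u = s := by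
  refine ⟨(integrable_const 1).indicator measurableSet_Iic, ?_⟩
  rw [integral_indicator measurableSet_Iic, Measure.restrict_restrict measurableSet_Iic,
    inter_comm, Ioc_inter_Iic, min_eq_right hs.2]
  simp [hs.1]

/-- The covariance of the Brownian bridge on the unit interval. -/
lemma posSemidef_brownianBridge :
    (Matrix.of fun s t : Icc (0 : ℝ) 1 => min (s : ℝ) t - s * t).PosSemidef := by
  have hmin : ∀ s t : Icc (0 : ℝ) 1, min (s : ℝ) t ∈ Icc (0 : ℝ) 1 := fun s t =>
    ⟨le_min s.2.1 t.2.1, (min_le_left _ _).trans s.2.2⟩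
  have hi : ∀ s t : Icc (0 : ℝ) 1, Integrable (fun u =>
      (Iic (min (s : ℝ) t)).indicator (fun _ => (1 : ℝ)) u -
        t * (Iic (s : ℝ)).indicator (fun _ => (1 : ℝ)) u -
        s * (Iic (t : ℝ)).indicator (fun _ => (1 : ℝ)) u + s * t)
      (volume.restrict (Ioc (0 : ℝ) 1)) := fun s t =>
    (((integral_indicator_Iic_Ioc (hmin s t)).1.sub
      ((integral_indicator_Iic_Ioc s.2).1.const_mul _)).sub
      ((integral_indicator_Iic_Ioc t.2).1.const_mul _)).add (integrable_const _)
  -- The covariance is ∫ (1_{u ≤ s} − s)(1_{u ≤ t} − t) du over (0, 1], a mixture of rank-one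
  -- kernels.
  refine posSemidef_congr (posSemidef_integral hi (Eventually.of_forall fun u => ?_)) fun s t => ?_
  · refine posSemidef_congr (posSemidef_rankOne fun s : Icc (0 : ℝ) 1 =>
      (Iic (s : ℝ)).indicator (fun _ => (1 : ℝ)) u - s) fun s t => ?_
    have : (Iic (min (s : ℝ) t)).indicator (fun _ => (1 : ℝ)) u =
        (Iic (s : ℝ)).indicator (fun _ => (1 : ℝ)) u *
          (Iic (t : ℝ)).indicator (fun _ => (1 : ℝ)) u := by
      by_cases hs : u ≤ s <;> by_cases ht : u ≤ t <;> simp [indicator, hs, ht]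
    rw [this]
    ring
  · obtain ⟨i1, v1⟩ := integral_indicator_Iic_Ioc (hmin s t)
    obtain ⟨i2, v2⟩ := integral_indicator_Iic_Ioc s.2
    obtain ⟨i3, v3⟩ := integral_indicator_Iic_Ioc t.2
    have e1 := integral_add ((i1.sub (i2.const_mul (t : ℝ))).sub (i3.const_mul (s : ℝ)))
      (integrable_const ((s : ℝ) * t))
    have e2 := integral_sub (i1.sub (i2.const_mul (t : ℝ))) (i3.const_mul (s : ℝ))
    have e3 := integral_sub i1 (i2.const_mul (t : ℝ))
    simp only [Pi.sub_apply] at e1 e2 e3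
    rw [e1, e2, e3, integral_const_mul, integral_const_mul, v1, v2, v3]
    simp
    ring

/-- The kernel of the linear images of a Gaussian vector. -/
lemma posSemidef_linearImage {X : Type u} {V : Type*} [Fintype V] [DecidableEq V]
    {M : Matrix V V ℝ} (hM : M.PosSemidef) (w : X → V → ℝ) :
    (Matrix.of fun x y => ∑ a, ∑ b, w x a * M a b * w y b).PosSemidef := by
  obtain ⟨B, rfl⟩ : ∃ B : Matrix V V ℝ, M = B.conjTranspose * B := by
    open scoped MatrixOrder Matrix.Norms.L2Operator in
    exact CStarAlgebra.nonneg_iff_eq_star_mul_self.mp hM.nonneg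
  refine posSemidef_congr (posSemidef_sum Finset.univ fun r _ =>
    posSemidef_rankOne fun x => ∑ a, w x a * B r a) fun x y => ?_
  simp only [Matrix.mul_apply, Matrix.conjTranspose_apply, star_trivial, Finset.sum_mul,
    Finset.mul_sum]
  rw [Finset.sum_comm' (t' := Finset.univ) (s' := fun _ => Finset.univ) (by simp)]
  conv_lhs => enter [2, b]; rw [Finset.sum_comm]
  rw [Finset.sum_comm]
  refine Finset.sum_congr rfl fun r _ => Finset.sum_congr rfl fun a _ =>
    Finset.sum_congr rfl fun b _ => ?_
  ring

lemma variogram_nonneg {X : Type u} {k : X → X → ℝ} (hk : (Matrix.of k).PosSemidef) (x y : X) :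
    0 ≤ k x x + k y y - 2 * k x y := by
  have h := (posSemidef_shift hk y).diag_nonneg (i := x)
  have := symm_of_posSemidef hk x y
  simp only [Matrix.of_apply] at h
  linarith

end RadialKernel

namespace EuclideanGraph

open RadialKernel

variable {X : Type u} (G : EuclideanGraph X)

lemma len_pos {e : Sym2 G.verts} (he : e ∈ G.graph.edgeSet) : 0 < G.len e :=
  sub_pos.2 (G.lo_lt_hi e he)

lemma edgeOf_mem {x : X} (hx : x ∉ G.verts) : G.edgeOf x hx ∈ G.graph.edgeSet :=
  (G.exists_edge_of_notMem hx).choose_spec.1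

lemma mem_edgePts_edgeOf {x : X} (hx : x ∉ G.verts) : x ∈ G.edgePts (G.edgeOf x hx) :=
  (G.exists_edge_of_notMem hx).choose_spec.2

lemma tail_ne_head {e : Sym2 G.verts} (he : e ∈ G.graph.edgeSet) : G.tail e ≠ G.head e := by
  have h := he
  rw [G.endpoints e he, SimpleGraph.mem_edgeSet] at h
  exact h.ne

lemma adj_tail_head {e : Sym2 G.verts} (he : e ∈ G.graph.edgeSet) :
    G.graph.Adj (G.tail e) (G.head e) := by
  rw [← SimpleGraph.mem_edgeSet, ← G.endpoints e he]
  exact he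

lemma notMem_verts {e : Sym2 G.verts} (he : e ∈ G.graph.edgeSet) {x : X} (hx : x ∈ G.edgePts e) :
    x ∉ G.verts := fun h =>
  disjoint_left.1 (G.edgePts_disjoint_verts e he) hx h

lemma eq_of_mem_edgePts {e f : Sym2 G.verts} (he : e ∈ G.graph.edgeSet) (hf : f ∈ G.graph.edgeSet)
    {x : X} (hxe : x ∈ G.edgePts e) (hxf : x ∈ G.edgePts f) : e = f := by
  by_contra h
  exact disjoint_left.1 (G.edgePts_disjoint he hf h) hxe hxf

lemma edgeOf_eq {e : Sym2 G.verts} (he : e ∈ G.graph.edgeSet) {x : X} (hx : x ∈ G.edgePts e)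
    (hx' : x ∉ G.verts) : G.edgeOf x hx' = e :=
  G.eq_of_mem_edgePts (G.edgeOf_mem hx') he (G.mem_edgePts_edgeOf hx') hx

lemma frac_of_mem {x : X} (hx : x ∈ G.verts) : G.frac x = 0 := by
  rw [frac, dif_pos hx]

lemma frac_mem_Ioo {x : X} (hx : x ∉ G.verts) : G.frac x ∈ Ioo (0 : ℝ) 1 := by
  rw [frac, dif_neg hx]
  have h := (G.coord_bijOn _ (G.edgeOf_mem hx)).mapsTo (G.mem_edgePts_edgeOf hx)
  have hl := G.len_pos (G.edgeOf_mem hx)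
  refine ⟨div_pos (sub_pos.2 h.1) hl, (div_lt_one hl).2 ?_⟩
  rw [len]
  linarith [h.2]

lemma frac_mem_Icc (x : X) : G.frac x ∈ Icc (0 : ℝ) 1 := by
  by_cases hx : x ∈ G.verts
  · rw [G.frac_of_mem hx]; simp
  · exact Ioo_subset_Icc_self (G.frac_mem_Ioo hx)

lemma conductance_symm (a b : G.verts) : G.conductance a b = G.conductance b a := by
  by_cases h : G.graph.Adj a b
  · rw [conductance, conductance, if_pos h, if_pos h.symm, Sym2.eq_swap]
  · rw [conductance, conductance, if_neg h, if_neg fun h' => h h'.symm]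

lemma conductance_nonneg (a b : G.verts) : 0 ≤ G.conductance a b := by
  unfold conductance
  split_ifs with h
  · exact (one_div_pos.2 (G.len_pos h)).le
  · exact le_rfl

lemma conductance_pos {a b : G.verts} (h : G.graph.Adj a b) : 0 < G.conductance a b := by
  rw [conductance, if_pos h]
  exact one_div_pos.2 (G.len_pos h)

lemma conductance_self (a : G.verts) : G.conductance a a = 0 := by
  simp [conductance]

lemma laplacian_symm (o a b : G.verts) : G.laplacian o a b = G.laplacian o b a := by
  simp only [laplacian, Matrix.of_apply]
  by_cases h : a = b
  · rw [h]
  · rw [if_neg h, if_neg (Ne.symm h), conductance_symm]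

open Classical in
lemma laplacian_mulVec (o : G.verts) (x : G.verts → ℝ) (a : G.verts) :
    (G.laplacian o).mulVec x a = (if a = o then x o else 0) +
      ∑ b, G.conductance a b * (x a - x b) := by
  classical
  have h : ∀ b, G.laplacian o a b * x b = (if a = b then (if a = o then x o else 0) +
      (∑ c, G.conductance a c) * x a else 0) - G.conductance a b * x b := fun b => by
    simp only [laplacian, Matrix.of_apply]
    by_cases hab : a = b
    · subst hab
      rw [if_pos rfl, if_pos rfl, conductance_self]
      split_ifs with hao
      · subst hao; ring
      · ring
    · rw [if_neg hab, if_neg hab]; ring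
  simp only [Matrix.mulVec, dotProduct]
  simp_rw [h, mul_sub]
  rw [Finset.sum_sub_distrib, Finset.sum_sub_distrib, Finset.sum_ite_eq, ← Finset.sum_mul,
    if_pos (Finset.mem_univ a)]
  ring

/-- Dirichlet energy plus the grounding term at the origin; the factor 1/2 compensates for summing
over ordered pairs. -/
lemma laplacian_quadratic (o : G.verts) (x : G.verts → ℝ) :
    x ⬝ᵥ (G.laplacian o).mulVec x =
      x o ^ 2 + 2⁻¹ * ∑ a, ∑ b, G.conductance a b * (x a - x b) ^ 2 := by
  classical
  have h1 : ∑ a, ∑ b, G.conductance a b * (x a - x b) ^ 2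
      = ∑ a, ∑ b, x a * (G.conductance a b * (x a - x b))
        + ∑ a, ∑ b, x a * (G.conductance a b * (x a - x b)) := by
    conv_rhs => enter [2]; rw [Finset.sum_comm]
    rw [← Finset.sum_add_distrib]
    refine Finset.sum_congr rfl fun a _ => ?_
    rw [← Finset.sum_add_distrib]
    refine Finset.sum_congr rfl fun b _ => ?_
    rw [G.conductance_symm b a]
    ring
  rw [h1]
  simp only [dotProduct, laplacian_mulVec, mul_add, Finset.sum_add_distrib, Finset.mul_sum]
  simp only [mul_ite, mul_zero, Finset.sum_ite_eq', Finset.mem_univ, if_true]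
  simp only [← Finset.mul_sum]
  ring

/-- If the energy is not positive, then `x` vanishes at the origin and is constant across every
edge, hence zero by connectedness. -/
lemma laplacian_posDef (o : G.verts) : (G.laplacian o).PosDef := by
  refine Matrix.PosDef.of_dotProduct_mulVec_pos
    (Matrix.IsHermitian.ext fun a b => by simpa using G.laplacian_symm o b a) fun {x} hx => ?_
  rw [star_trivial, laplacian_quadratic]
  have hnn : ∀ a b, 0 ≤ G.conductance a b * (x a - x b) ^ 2 := fun a b =>
    mul_nonneg (G.conductance_nonneg a b) (sq_nonneg _)
  have hS : 0 ≤ ∑ a, ∑ b, G.conductance a b * (x a - x b) ^ 2 :=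
    Finset.sum_nonneg fun a _ => Finset.sum_nonneg fun b _ => hnn a b
  by_contra hle
  have h0 : x o = 0 := by
    have : x o ^ 2 = 0 := by nlinarith [sq_nonneg (x o)]
    simpa using this
  have hS0 : ∑ a, ∑ b, G.conductance a b * (x a - x b) ^ 2 = 0 := by
    nlinarith [sq_nonneg (x o)]
  have hadj : ∀ a b, G.graph.Adj a b → x a = x b := fun a b hab => by
    have h1 := (Finset.sum_eq_zero_iff_of_nonneg fun a _ =>
      Finset.sum_nonneg fun b _ => hnn a b).1 hS0 a (Finset.mem_univ a)
    have h2 := (Finset.sum_eq_zero_iff_of_nonneg fun b _ => hnn a b).1 h1 b (Finset.mem_univ b)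
    have h3 := (mul_eq_zero.1 h2).resolve_left (G.conductance_pos hab).ne'
    exact sub_eq_zero.1 (by simpa using h3)
  have hwalk : ∀ {a b : G.verts} (p : G.graph.Walk a b), x a = x b := fun p => by
    induction p with
    | nil => rfl
    | cons h _ ih => exact (hadj _ _ h).trans ih
  refine hx (funext fun a => ?_)
  obtain ⟨p⟩ := G.connected.preconnected a o
  rw [hwalk p, h0, Pi.zero_apply]

open Classical in
/-- The weights of linear interpolation from the vertices. -/
def interpWeight (x : X) (a : G.verts) : ℝ :=
  (if a = G.upperVert x then G.frac x else 0) + (if a = G.lowerVert x then 1 - G.frac x else 0)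

lemma sum_interpWeight_mul (x : X) (F : G.verts → ℝ) : ∑ a, G.interpWeight x a * F a =
    G.frac x * F (G.upperVert x) + (1 - G.frac x) * F (G.lowerVert x) := by
  classical
  simp [interpWeight, add_mul, Finset.sum_add_distrib]

open Classical in
lemma covVertex_eq (o : G.verts) (x y : X) : G.covVertex o x y =
    ∑ a, ∑ b, G.interpWeight x a * (G.laplacian o)⁻¹ a b * G.interpWeight y b := by
  have : ∀ a, ∑ b, G.interpWeight x a * (G.laplacian o)⁻¹ a b * G.interpWeight y b =
      G.interpWeight x a * ∑ b, G.interpWeight y b * (G.laplacian o)⁻¹ a b := fun a => by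
    rw [Finset.mul_sum]
    exact Finset.sum_congr rfl fun b _ => by ring
  simp_rw [this]
  rw [sum_interpWeight_mul, sum_interpWeight_mul, sum_interpWeight_mul, covVertex]
  ring

/-- At a vertex the weights form an indicator. Inside an edge they are supported exactly on the two
end vertices, which determine the edge, and the weight of the head gives the coordinate. Hence the
vertex field can tell any two points apart. -/
lemma interpWeight_injective : Function.Injective G.interpWeight := by
  classical
  have hvert : ∀ x (hx : x ∈ G.verts), G.interpWeight x = fun a => if a = ⟨x, hx⟩ then 1 else 0 :=
    fun x hx => by
      funext a
      simp [interpWeight, G.frac_of_mem hx, lowerVert, hx]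
  have hedge : ∀ {x} (hx : x ∉ G.verts), G.interpWeight x (G.head (G.edgeOf x hx)) = G.frac x ∧
      G.interpWeight x (G.tail (G.edgeOf x hx)) = 1 - G.frac x ∧
      ∀ a, G.interpWeight x a ≠ 0 → a = G.head (G.edgeOf x hx) ∨ a = G.tail (G.edgeOf x hx) :=
    fun {x} hx => by
      have hne := G.tail_ne_head (G.edgeOf_mem hx)
      refine ⟨?_, ?_, fun a ha => ?_⟩
      · simp [interpWeight, upperVert, lowerVert, hx, hne.symm]
      · simp [interpWeight, upperVert, lowerVert, hx, hne]
      · by_contra hcon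
        push Not at hcon
        simp [interpWeight, upperVert, lowerVert, hx, hcon.1, hcon.2] at ha
  have hmixed : ∀ {x y}, x ∈ G.verts → y ∉ G.verts → G.interpWeight x ≠ G.interpWeight y :=
    fun {x y} hx hy h => by
      have h1 := congrFun h (G.head (G.edgeOf y hy))
      rw [(hedge hy).1, hvert x hx] at h1
      have := G.frac_mem_Ioo hy
      simp only at h1
      split_ifs at h1
      · exact this.2.ne h1.symm
      · exact this.1.ne h1
  intro x y hxy
  by_cases hx : x ∈ G.verts <;> by_cases hy : y ∈ G.verts
  · have h1 := congrFun hxy ⟨x, hx⟩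
    rw [hvert x hx, hvert y hy] at h1
    by_contra hne
    simp [hne] at h1
  · exact (hmixed hx hy hxy).elim
  · exact (hmixed hy hx hxy.symm).elim
  · have hfx := G.frac_mem_Ioo hx
    have hne := G.tail_ne_head (G.edgeOf_mem hx)
    have h1 := (hedge hy).2.2 (G.head (G.edgeOf x hx)) (by
      rw [← hxy, (hedge hx).1]; exact hfx.1.ne')
    have h2 := (hedge hy).2.2 (G.tail (G.edgeOf x hx)) (by
      rw [← hxy, (hedge hx).2.1]; exact (sub_pos.2 hfx.2).ne')
    have he : G.edgeOf x hx = G.edgeOf y hy := by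
      rw [G.endpoints _ (G.edgeOf_mem hx), G.endpoints _ (G.edgeOf_mem hy), Sym2.eq_iff]
      rcases h1 with h1 | h1 <;> rcases h2 with h2 | h2
      · exact (hne (h2.trans h1.symm)).elim
      · exact Or.inl ⟨h2, h1⟩
      · exact Or.inr ⟨h2, h1⟩
      · exact (hne (h2.trans h1.symm)).elim
    have hf : G.frac x = G.frac y := by
      rw [← (hedge hx).1, ← (hedge hy).1, hxy, he]
    have hmy := G.mem_edgePts_edgeOf hy
    rw [frac, frac, dif_neg hx, dif_neg hy, ← he,
      div_left_inj' (G.len_pos (G.edgeOf_mem hx)).ne'] at hf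
    rw [← he] at hmy
    exact (G.coord_bijOn _ (G.edgeOf_mem hx)).injOn (G.mem_edgePts_edgeOf hx) hmy (by linarith)

lemma posSemidef_covVertex (o : G.verts) : (Matrix.of (G.covVertex o)).PosSemidef := by
  classical
  refine posSemidef_congr (posSemidef_linearImage (G.laplacian_posDef o).inv.posSemidef
    G.interpWeight) fun x y => ?_
  rw [covVertex_eq]

lemma posSemidef_covEdge {e : Sym2 G.verts} (he : e ∈ G.graph.edgeSet) :
    (Matrix.of (G.covEdge e)).PosSemidef := by
  classical
  refine posSemidef_congr (posSemidef_const_mul (posSemidef_mul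
    (posSemidef_rankOne fun x => if x ∈ G.edgePts e then (1 : ℝ) else 0)
    (posSemidef_comp posSemidef_brownianBridge fun x => ⟨G.frac x, G.frac_mem_Icc x⟩))
    (G.len_pos he).le) fun x y => ?_
  unfold covEdge
  by_cases hx : x ∈ G.edgePts e <;> by_cases hy : y ∈ G.edgePts e <;> simp [hx, hy]
  ring

lemma posSemidef_sum_covEdge (o : G.verts) :
    (Matrix.of fun x y => G.cov o x y - G.covVertex o x y).PosSemidef := by
  classical
  refine posSemidef_congr (posSemidef_sum G.graph.edgeFinset
    fun e he => G.posSemidef_covEdge (SimpleGraph.mem_edgeFinset.1 he)) fun x y => ?_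
  rw [cov, add_sub_cancel_left]

/-- The bridges contribute a nonnegative variance. The variance from the vertex field is the form of
the inverse Laplacian at the difference of two weight vectors, which is nonzero. -/
lemma resistanceDist_pos (o : G.verts) {x y : X} (hxy : x ≠ y) : 0 < G.resistanceDist o x y := by
  classical
  have h1 := variogram_nonneg (G.posSemidef_sum_covEdge o) x y
  have h2 : 0 < G.covVertex o x x + G.covVertex o y y - 2 * G.covVertex o x y := by
    have hne : G.interpWeight x - G.interpWeight y ≠ 0 :=
      sub_ne_zero.2 (G.interpWeight_injective.ne hxy)
    have h := (G.laplacian_posDef o).inv.dotProduct_mulVec_pos hne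
    have hs := symm_of_posSemidef (G.posSemidef_covVertex o) y x
    have hB : ∀ x y, G.covVertex o x y =
        G.interpWeight x ⬝ᵥ (G.laplacian o)⁻¹.mulVec (G.interpWeight y) := fun x y => by
      rw [covVertex_eq]
      simp only [dotProduct, Matrix.mulVec, Finset.mul_sum, mul_assoc]
    rw [star_trivial, Matrix.mulVec_sub, dotProduct_sub, sub_dotProduct, sub_dotProduct, ← hB,
      ← hB, ← hB, ← hB, hs] at h
    linarith
  rw [resistanceDist]
  linarith

lemma isShiftedVariogram_resistanceDist (o : G.verts) :
    IsShiftedVariogram 0 (G.resistanceDist o) where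
  cnd := by
    refine IsCND.variogram (posSemidef_congr (posSemidef_add (G.posSemidef_covVertex o)
      (G.posSemidef_sum_covEdge o)) fun x y => ?_)
    ring
  nonneg := le_rfl
  diag x := by rw [resistanceDist]; ring
  lt x y hxy := G.resistanceDist_pos o hxy

end EuclideanGraph

/-! ### Chains, paths and a criterion for computing the geodesic metric. -/

namespace EuclideanGraph

open RadialKernel

variable {X : Type u} (G : EuclideanGraph X)

/-- `G.Chain n x y r`: there are `n` consecutive steps from `x` to `y` of total length `r`, each
of them inside a closed edge.  Points may be repeated and steps may overlap. -/
inductive Chain : ℕ → X → X → ℝ → Prop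
  | nil (x : X) : Chain 0 x x 0
  | cons {n : ℕ} {x y z : X} {r : ℝ} {e : Sym2 G.verts} (he : e ∈ G.graph.edgeSet)
      (hx : x ∈ G.closedEdge e) (hy : y ∈ G.closedEdge e) (h : Chain n y z r) :
      Chain (n + 1) x z (|G.coord e x - G.coord e y| + r)

variable {G}

namespace Chain

lemma cast {n m : ℕ} {x y : X} {r s : ℝ} (h : G.Chain n x y r) (hn : n = m) (hr : r = s) :
    G.Chain m x y s := by subst hn hr; exact h

lemma single {x y : X} {e : Sym2 G.verts} (he : e ∈ G.graph.edgeSet)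
    (hx : x ∈ G.closedEdge e) (hy : y ∈ G.closedEdge e) :
    G.Chain 1 x y |G.coord e x - G.coord e y| :=
  (cons he hx hy (nil y)).cast rfl (add_zero _)

lemma append {n m : ℕ} {x y z : X} {r s : ℝ} (h : G.Chain n x y r) (h' : G.Chain m y z s) :
    G.Chain (n + m) x z (r + s) := by
  induction h with
  | nil x => exact h'.cast (zero_add m).symm (zero_add s).symm
  | cons he hx hy _ ih => exact (cons he hx hy (ih h')).cast (by omega) (by ring)

lemma symm {n : ℕ} {x y : X} {r : ℝ} (h : G.Chain n x y r) : G.Chain n y x r := by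
  induction h with
  | nil x => exact nil x
  | cons he hx hy _ ih =>
    exact (ih.append (single he hy hx)).cast rfl (by rw [abs_sub_comm]; ring)

lemma nonneg {n : ℕ} {x y : X} {r : ℝ} (h : G.Chain n x y r) : 0 ≤ r := by
  induction h with
  | nil x => exact le_rfl
  | cons he hx hy _ ih => positivity

end Chain

lemma tail_mem_closedEdge (e : Sym2 G.verts) : (G.tail e : X) ∈ G.closedEdge e :=
  Or.inr (Or.inl rfl)

lemma head_mem_closedEdge (e : Sym2 G.verts) : (G.head e : X) ∈ G.closedEdge e :=
  Or.inr (Or.inr rfl)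

lemma coord_injOn {e : Sym2 G.verts} (he : e ∈ G.graph.edgeSet) :
    InjOn (G.coord e) (G.closedEdge e) := by
  have hlt := G.lo_lt_hi e he
  have hio := fun x hx => (G.coord_bijOn e he).mapsTo (x := x) hx
  have ht := G.coord_tail e he
  have hh := G.coord_head e he
  rintro x (hx | rfl | rfl) y (hy | rfl | rfl) hxy
  · exact (G.coord_bijOn e he).injOn hx hy hxy
  · exact absurd (hxy.trans ht) (hio x hx).1.ne'
  · exact absurd (hxy.trans hh) (hio x hx).2.ne
  · exact absurd (hxy.symm.trans ht) (hio y hy).1.ne'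
  · rfl
  · rw [ht, hh] at hxy; exact absurd hxy hlt.ne
  · exact absurd (hxy.symm.trans hh) (hio y hy).2.ne
  · rw [ht, hh] at hxy; exact absurd hxy hlt.ne'
  · rfl

lemma coord_mem_Icc {e : Sym2 G.verts} (he : e ∈ G.graph.edgeSet) {x : X}
    (hx : x ∈ G.closedEdge e) : G.coord e x ∈ Icc (G.lo e) (G.hi e) := by
  have hlt := G.lo_lt_hi e he
  rcases hx with hx | rfl | rfl
  · exact Ioo_subset_Icc_self ((G.coord_bijOn e he).mapsTo hx)
  · rw [G.coord_tail e he]; exact ⟨le_rfl, hlt.le⟩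
  · rw [G.coord_head e he]; exact ⟨hlt.le, le_rfl⟩

lemma Chain.eq_of_zero {n : ℕ} {x y : X} {r : ℝ} (h : G.Chain n x y r) (hr : r = 0) : x = y := by
  induction h with
  | nil x => rfl
  | @cons n x y z r e he hx hy h ih =>
    have h1 := h.nonneg
    have h2 := abs_nonneg (G.coord e x - G.coord e y)
    rw [coord_injOn he hx hy (sub_eq_zero.1 (abs_eq_zero.1 (by linarith)))]
    exact ih (by linarith)

/-- The points and edges of a chain as sequences. -/
lemma Chain.exists_seq {n : ℕ} {x y : X} {r : ℝ} (h : G.Chain n x y r) :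
    ∃ (p : ℕ → X) (q : ℕ → Sym2 G.verts), p 0 = x ∧ p n = y ∧
      (∀ i < n, q i ∈ G.graph.edgeSet ∧ p i ∈ G.closedEdge (q i) ∧
        p (i + 1) ∈ G.closedEdge (q i)) ∧
      r = ∑ i ∈ Finset.range n, |G.coord (q i) (p (i + 1)) - G.coord (q i) (p i)| := by
  induction h with
  | nil x =>
    obtain ⟨v⟩ := G.connected.nonempty
    -- The loop `s(v, v)` is only a default value: a chain without steps uses no edge.
    exact ⟨fun _ => x, fun _ => s(v, v), rfl, rfl, by simp, by simp⟩
  | @cons n x y z r e he hx hy h ih =>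
    obtain ⟨p, q, h0, hn, hpq, hr⟩ := ih
    refine ⟨fun i => Nat.casesOn i x p, fun i => Nat.casesOn i e q, rfl, hn, ?_, ?_⟩
    · rintro (_ | i) hi
      · exact ⟨he, hx, by rw [← h0] at hy; exact hy⟩
      · exact hpq i (by omega)
    · rw [Finset.sum_range_succ', hr, add_comm, abs_sub_comm, ← h0]
      rfl

lemma chain_of_seq {p : ℕ → X} {q : ℕ → Sym2 G.verts} {n : ℕ}
    (hpq : ∀ i < n, q i ∈ G.graph.edgeSet ∧ p i ∈ G.closedEdge (q i) ∧
        p (i + 1) ∈ G.closedEdge (q i)) {i j : ℕ} (hij : i ≤ j) (hj : j ≤ n) :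
    G.Chain (j - i) (p i) (p j)
      (∑ k ∈ Finset.Ico i j, |G.coord (q k) (p (k + 1)) - G.coord (q k) (p k)|) := by
  induction j, hij using Nat.le_induction with
  | base => exact (Chain.nil _).cast (by omega) (by simp)
  | succ j hij ih =>
    obtain ⟨h1, h2, h3⟩ := hpq j (by omega)
    refine ((ih (by omega)).append (Chain.single h1 h2 h3)).cast (by omega) ?_
    rw [Finset.sum_Ico_succ_top hij, abs_sub_comm (G.coord (q j) (p j))]

/-- When two steps on one edge overlap at `z`, going directly from the start of the first to the end
of the second costs no more than both. -/
lemma abs_sub_le_of_uIoo {a b c d z : ℝ} (h1 : z ∈ uIoo a b) (h2 : z ∈ uIoo c d) :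
    |a - d| ≤ |b - a| + |d - c| := by
  have h3 := abs_sub_left_of_mem_uIcc (uIoo_subset_uIcc_self h1)
  have h4 := abs_sub_right_of_mem_uIcc (uIoo_subset_uIcc_self h2)
  have h5 := abs_sub_le a z d
  rw [abs_sub_comm a z] at h5
  rw [abs_sub_comm d z] at h4
  linarith

/-- Every chain can be shortened to a path. -/
lemma Chain.exists_path {n : ℕ} {x y : X} {r : ℝ} (h : G.Chain n x y r) :
    ∃ p : G.EPath x y, p.length ≤ r := by
  induction n using Nat.strong_induction_on generalizing r with
  | _ n ih =>
  have shorten : ∀ {m s}, G.Chain m x y s → m < n → s ≤ r → ∃ p : G.EPath x y, p.length ≤ r :=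
    fun hc hm hs => (ih _ hm hc).imp fun p hp => hp.trans hs
  obtain ⟨p, q, h0, hn, hpq, hr⟩ := h.exists_seq
  set f : ℕ → ℝ := fun k => |G.coord (q k) (p (k + 1)) - G.coord (q k) (p k)| with hf
  have hsplit : ∀ {i j}, i ≤ j → j ≤ n →
      r = ∑ k ∈ Finset.Ico 0 i, f k + ∑ k ∈ Finset.Ico i j, f k + ∑ k ∈ Finset.Ico j n, f k :=
    fun hij hj => by
      rw [Finset.sum_Ico_consecutive _ (Nat.zero_le _) hij,
        Finset.sum_Ico_consecutive _ (Nat.zero_le _) hj, hr, Finset.range_eq_Ico]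
  have hnn : ∀ i j, 0 ≤ ∑ k ∈ Finset.Ico i j, f k := fun i j =>
    Finset.sum_nonneg fun k _ => abs_nonneg _
  -- A repeated point: cut out the loop between its two occurrences.
  by_cases hinj : ∃ i j, i < j ∧ j ≤ n ∧ p i = p j
  · obtain ⟨i, j, hij, hj, hp⟩ := hinj
    have c1 := chain_of_seq hpq (Nat.zero_le i) (hij.le.trans hj)
    have c2 := chain_of_seq hpq hj le_rfl
    rw [h0, hp] at c1
    rw [hn] at c2
    refine shorten (c1.append c2) (by omega) ?_
    rw [hsplit hij.le hj]
    linarith [hnn i j]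
  -- Overlapping partial edges share an interior point, so they lie on the same edge. A single step
  -- from `p i` to `p (j + 1)` replaces everything from step `i` to step `j`.
  by_cases hov : ∃ i j, i < j ∧ j < n ∧
      ¬ Disjoint (G.partialEdge (q i) (p i) (p (i + 1))) (G.partialEdge (q j) (p j) (p (j + 1)))
  · obtain ⟨i, j, hij, hj, hd⟩ := hov
    obtain ⟨z, ⟨hz1, hz2⟩, hz3, hz4⟩ := not_disjoint_iff.1 hd
    obtain ⟨e1, m1, m1'⟩ := hpq i (hij.trans hj)
    obtain ⟨e2, m2, m2'⟩ := hpq j hj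
    have hqq := G.eq_of_mem_edgePts e1 e2 hz1 hz3
    rw [← hqq] at m2 m2' hz4
    have c1 := chain_of_seq hpq (Nat.zero_le i) (hij.le.trans hj.le)
    have c2 := chain_of_seq hpq hj le_rfl
    rw [h0] at c1
    rw [hn] at c2
    refine shorten ((c1.append (Chain.single e1 m1 m2')).append c2) (by omega) ?_
    rw [hsplit (show i ≤ j + 1 by omega) hj]
    have h1 : f i + f j ≤ ∑ k ∈ Finset.Ico i (j + 1), f k := by
      rw [Finset.sum_Ico_succ_top hij.le]
      have := Finset.single_le_sum (f := f) (fun k _ => abs_nonneg _)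
        (Finset.left_mem_Ico.2 hij)
      linarith
    have h2 := abs_sub_le_of_uIoo hz2 hz4
    have h3 : f j = |G.coord (q i) (p (j + 1)) - G.coord (q i) (p j)| := by rw [hf, hqq]
    have h4 : f i = |G.coord (q i) (p (i + 1)) - G.coord (q i) (p i)| := rfl
    linarith
  push Not at hinj hov
  refine ⟨⟨n, fun i => p i, fun i => q i, h0, hn, fun i j hij => ?_, fun i => (hpq i i.2).1,
    fun i => (hpq i i.2).2.1, fun i => (hpq i i.2).2.2, fun i j hij => ?_⟩, ?_⟩
  · rcases lt_trichotomy i j with hlt | heq | hlt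
    · exact absurd hij (hinj i j hlt (by omega))
    · exact heq
    · exact absurd hij.symm (hinj j i hlt (by omega))
  · rcases lt_or_gt_of_ne hij with hlt | hlt
    · exact hov i j hlt j.2
    · exact (hov j i hlt i.2).symm
  · rw [hr, Finset.sum_range]
    exact le_rfl

lemma le_length_of_step {D : X → X → ℝ} (h0 : ∀ x, D x x = 0)
    (htri : ∀ x y z, D x z ≤ D x y + D y z)
    (hstep : ∀ e ∈ G.graph.edgeSet, ∀ x ∈ G.closedEdge e, ∀ y ∈ G.closedEdge e,
      D x y ≤ |G.coord e x - G.coord e y|)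
    {x y : X} (p : G.EPath x y) : D x y ≤ p.length := by
  have hsum : ∀ (n : ℕ) (f : Fin (n + 1) → X),
      D (f 0) (f (Fin.last n)) ≤ ∑ i : Fin n, D (f i.castSucc) (f i.succ) := fun n => by
    induction n with
    | zero => intro f; simp [h0]
    | succ n ih =>
      intro f
      rw [Fin.sum_univ_castSucc]
      exact (htri _ _ _).trans (add_le_add_left (ih fun i => f i.castSucc) _)
  have h1 := hsum p.n p.pts
  rw [p.pts_zero, p.pts_last] at h1
  refine h1.trans (Finset.sum_le_sum fun i _ => ?_)
  rw [abs_sub_comm]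
  exact hstep _ (p.edge_mem i) _ (p.left_mem i) _ (p.right_mem i)

/-- A criterion for computing the geodesic metric. -/
lemma geodesicDist_eq {D : X → X → ℝ} (h0 : ∀ x, D x x = 0)
    (htri : ∀ x y z, D x z ≤ D x y + D y z)
    (hstep : ∀ e ∈ G.graph.edgeSet, ∀ x ∈ G.closedEdge e, ∀ y ∈ G.closedEdge e,
      D x y ≤ |G.coord e x - G.coord e y|)
    (hch : ∀ x y, ∃ n, G.Chain n x y (D x y)) (x y : X) : G.geodesicDist x y = D x y := by
  refine IsLeast.csInf_eq ⟨?_, ?_⟩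
  · obtain ⟨n, hn⟩ := hch x y
    obtain ⟨p, hp⟩ := hn.exists_path
    exact ⟨p, le_antisymm (le_length_of_step h0 htri hstep p) hp⟩
  · rintro r ⟨p, rfl⟩
    exact le_length_of_step h0 htri hstep p

/-- Positivity off the diagonal follows from the chain that realizes `D`: a chain of length zero
never moves. -/
lemma isShiftedVariogram_geodesicDist {D : X → X → ℝ} (hD : IsCND D) (h0 : ∀ x, D x x = 0)
    (htri : ∀ x y z, D x z ≤ D x y + D y z)
    (hstep : ∀ e ∈ G.graph.edgeSet, ∀ x ∈ G.closedEdge e, ∀ y ∈ G.closedEdge e,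
      D x y ≤ |G.coord e x - G.coord e y|)
    (hch : ∀ x y, ∃ n, G.Chain n x y (D x y)) : IsShiftedVariogram 0 G.geodesicDist := by
  obtain h : G.geodesicDist = D := funext₂ (geodesicDist_eq h0 htri hstep hch)
  rw [h]
  refine ⟨hD, le_rfl, h0, fun x y hxy => ?_⟩
  obtain ⟨n, hn⟩ := hch x y
  exact hn.nonneg.lt_of_ne fun h => hxy (hn.eq_of_zero h.symm)

end EuclideanGraph

/-! ### Euclidean trees: an ℓ¹ metric from projections to the edges. -/

namespace RadialKernel

/-- Adding s t to the bridge covariance gives min(s, t), the covariance of Brownian motion, whose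
variogram is |s − t|. -/
lemma isCND_abs_sub : IsCND fun s t : Icc (0 : ℝ) 1 => |(s : ℝ) - t| := by
  refine (IsCND.variogram (posSemidef_add posSemidef_brownianBridge
    (posSemidef_rankOne fun s : Icc (0 : ℝ) 1 => (s : ℝ)))).congr fun s t => ?_
  rcases le_total (s : ℝ) t with h | h
  · rw [abs_of_nonpos (by linarith), min_self, min_self, min_eq_left h]; ring
  · rw [abs_of_nonneg (by linarith), min_self, min_self, min_eq_right h]; ring

lemma isCND_abs_sub_comp {X : Type u} {f : X → ℝ} {l : ℝ} (hl : 0 < l)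
    (hf : ∀ x, f x ∈ Icc 0 l) : IsCND fun x y => |f x - f y| := by
  refine ((isCND_abs_sub.comp fun x => (⟨f x / l, div_nonneg (hf x).1 hl.le,
    (div_le_one hl).2 (hf x).2⟩ : Icc (0 : ℝ) 1)).const_mul hl.le).congr fun x y => ?_
  rw [← sub_div, abs_div, abs_of_pos hl, mul_div_cancel₀ _ hl.ne']

end RadialKernel

namespace EuclideanGraph

open RadialKernel

variable {X : Type u} (G : EuclideanGraph X)

lemma notMem_edgePts_of_ne {e f : Sym2 G.verts} (he : e ∈ G.graph.edgeSet)
    (hf : f ∈ G.graph.edgeSet) (hef : f ≠ e) {x : X} (hx : x ∈ G.closedEdge f) :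
    x ∉ G.edgePts e := fun hxe => by
  rcases hx with hx | rfl | rfl
  · exact hef (G.eq_of_mem_edgePts hf he hx hxe)
  · exact G.notMem_verts he hxe (G.tail f).2
  · exact G.notMem_verts he hxe (G.head f).2

lemma lowerVert_of_mem {x : X} (hx : x ∈ G.verts) : G.lowerVert x = ⟨x, hx⟩ := by
  rw [lowerVert, dif_pos hx]

lemma lowerVert_coe (v : G.verts) : G.lowerVert (v : X) = v := G.lowerVert_of_mem v.2

lemma lowerVert_mem_closedEdge {f : Sym2 G.verts} (hf : f ∈ G.graph.edgeSet) {x : X}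
    (hx : x ∈ G.closedEdge f) : G.lowerVert x = G.tail f ∨ G.lowerVert x = G.head f := by
  rcases hx with hx | rfl | rfl
  · have h := G.notMem_verts hf hx
    left
    rw [lowerVert, dif_neg h, G.edgeOf_eq hf hx h]
  · exact Or.inl (G.lowerVert_coe _)
  · exact Or.inr (G.lowerVert_coe _)

open Classical in
/-- The retraction onto the edge `e`, in the coordinate of the edge, that sends every point off the
edge to the end vertex from which it can be reached when the edge is removed. -/
def edgeProj (e : Sym2 G.verts) (x : X) : ℝ :=
  if x ∈ G.edgePts e then G.coord e x - G.lo e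
  else if (G.graph.deleteEdges {e}).Reachable (G.lowerVert x) (G.head e) then G.len e else 0

variable {G}

lemma edgeProj_of_notMem {e : Sym2 G.verts} {x : X} (hx : x ∉ G.edgePts e) :
    G.edgeProj e x = 0 ∨ G.edgeProj e x = G.len e := by
  rw [edgeProj, if_neg hx]
  split_ifs
  · exact Or.inr rfl
  · exact Or.inl rfl

lemma edgeProj_mem_Icc {e : Sym2 G.verts} (he : e ∈ G.graph.edgeSet) (x : X) :
    G.edgeProj e x ∈ Icc 0 (G.len e) := by
  have hl := G.len_pos he
  by_cases hx : x ∈ G.edgePts e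
  · rw [edgeProj, if_pos hx, len]
    have := coord_mem_Icc he (Or.inl hx)
    exact ⟨by linarith [this.1], by linarith [this.2]⟩
  · rcases edgeProj_of_notMem hx with h | h <;> rw [h]
    · exact ⟨le_rfl, hl.le⟩
    · exact ⟨hl.le, le_rfl⟩

lemma edgeProj_head {e : Sym2 G.verts} (he : e ∈ G.graph.edgeSet) :
    G.edgeProj e (G.head e) = G.len e := by
  rw [edgeProj, if_neg fun h => G.notMem_verts he h (G.head e).2, G.lowerVert_coe,
    if_pos (SimpleGraph.Reachable.refl _)]

/-- In an acyclic graph every edge is a bridge, so deleting `e` separates its tail from its head. -/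
lemma edgeProj_tail (hG : G.graph.IsAcyclic) {e : Sym2 G.verts} (he : e ∈ G.graph.edgeSet) :
    G.edgeProj e (G.tail e) = 0 := by
  rw [edgeProj, if_neg fun h => G.notMem_verts he h (G.tail e).2, G.lowerVert_coe, if_neg]
  have h := (SimpleGraph.isBridge_iff_forall_cycle_notMem he).2 fun u p hp => absurd hp (hG p)
  have he' := G.endpoints e he
  intro hr
  rw [he', SimpleGraph.isBridge_iff, ← he'] at h
  exact h hr

lemma edgeProj_of_mem (hG : G.graph.IsAcyclic) {e : Sym2 G.verts} (he : e ∈ G.graph.edgeSet)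
    {x : X} (hx : x ∈ G.closedEdge e) : G.edgeProj e x = G.coord e x - G.lo e := by
  rcases hx with hx | rfl | rfl
  · rw [edgeProj, if_pos hx]
  · rw [edgeProj_tail hG he, G.coord_tail e he, sub_self]
  · rw [edgeProj_head he, G.coord_head e he, len]

lemma edgeProj_eq_of_reachable {e : Sym2 G.verts} {x y : X} (hx : x ∉ G.edgePts e)
    (hy : y ∉ G.edgePts e)
    (h : (G.graph.deleteEdges {e}).Reachable (G.lowerVert x) (G.lowerVert y)) :
    G.edgeProj e x = G.edgeProj e y := by
  rw [edgeProj, edgeProj, if_neg hx, if_neg hy]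
  congr 1
  exact propext ⟨fun h' => h.symm.trans h', fun h' => h.trans h'⟩

/-- The edge `f` survives the deletion of `e`, so its two ends stay connected and all of its closed
edge projects to one end of `e`. -/
lemma edgeProj_eq_of_ne {e f : Sym2 G.verts} (he : e ∈ G.graph.edgeSet)
    (hf : f ∈ G.graph.edgeSet) (hef : f ≠ e) {x y : X} (hx : x ∈ G.closedEdge f)
    (hy : y ∈ G.closedEdge f) : G.edgeProj e x = G.edgeProj e y := by
  refine edgeProj_eq_of_reachable (G.notMem_edgePts_of_ne he hf hef hx)
    (G.notMem_edgePts_of_ne he hf hef hy) ?_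
  have hadj : (G.graph.deleteEdges {e}).Adj (G.tail f) (G.head f) := by
    rw [SimpleGraph.deleteEdges_adj, ← G.endpoints f hf]
    exact ⟨G.adj_tail_head hf, hef⟩
  rcases G.lowerVert_mem_closedEdge hf hx with h | h <;>
    rcases G.lowerVert_mem_closedEdge hf hy with h' | h' <;> rw [h, h']
  · exact hadj.reachable
  · exact hadj.symm.reachable

variable (G)

open Classical in
/-- The sum over the edges of the distances of the projections. -/
def treeDist (x y : X) : ℝ := ∑ e ∈ G.graph.edgeFinset, |G.edgeProj e x - G.edgeProj e y|

variable {G}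

/-- A form of "y lies between x and z": on every edge, one of the two legs projects to a point. -/
lemma treeDist_add {x y z : X} (h : ∀ e ∈ G.graph.edgeSet,
    G.edgeProj e x = G.edgeProj e y ∨ G.edgeProj e y = G.edgeProj e z) :
    G.treeDist x z = G.treeDist x y + G.treeDist y z := by
  classical
  rw [treeDist, treeDist, treeDist, ← Finset.sum_add_distrib]
  refine Finset.sum_congr rfl fun e he => ?_
  rcases h e (SimpleGraph.mem_edgeFinset.1 he) with h | h <;> simp [h]

lemma treeDist_of_mem (hG : G.graph.IsAcyclic) {e : Sym2 G.verts} (he : e ∈ G.graph.edgeSet)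
    {x y : X} (hx : x ∈ G.closedEdge e) (hy : y ∈ G.closedEdge e) :
    G.treeDist x y = |G.coord e x - G.coord e y| := by
  classical
  rw [treeDist, Finset.sum_eq_single e]
  · rw [edgeProj_of_mem hG he hx, edgeProj_of_mem hG he hy, sub_sub_sub_cancel_right]
  · intro f hf hfe
    rw [edgeProj_eq_of_ne (SimpleGraph.mem_edgeFinset.1 hf) he hfe.symm hx hy, sub_self, abs_zero]
  · intro h
    exact absurd (SimpleGraph.mem_edgeFinset.2 he) h

lemma treeDist_self (x : X) : G.treeDist x x = 0 := by simp [treeDist]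

lemma treeDist_comm (x y : X) : G.treeDist x y = G.treeDist y x :=
  Finset.sum_congr rfl fun _ _ => abs_sub_comm _ _

lemma treeDist_triangle (x y z : X) : G.treeDist x z ≤ G.treeDist x y + G.treeDist y z := by
  rw [treeDist, treeDist, treeDist, ← Finset.sum_add_distrib]
  exact Finset.sum_le_sum fun e _ => abs_sub_le _ _ _

lemma mem_closedEdge_of_adj {a b : G.verts} (h : G.graph.Adj a b) :
    (a : X) ∈ G.closedEdge s(a, b) ∧ (b : X) ∈ G.closedEdge s(a, b) := by
  have he := G.endpoints _ ((SimpleGraph.mem_edgeSet _).2 h)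
  rcases Sym2.eq_iff.1 he with ⟨h1, h2⟩ | ⟨h1, h2⟩
  · exact ⟨Or.inr (Or.inl (congrArg _ h1)), Or.inr (Or.inr (congrArg _ h2))⟩
  · exact ⟨Or.inr (Or.inr (congrArg _ h1)), Or.inr (Or.inl (congrArg _ h2))⟩

/-- After its first edge a path never uses that edge again, so the remainder projects to a point
there, while the first step projects to a point on all other edges. Lengths therefore add. -/
lemma exists_chain_treeDist_of_walk (hG : G.graph.IsAcyclic) {a b : G.verts}
    (p : G.graph.Walk a b) (hp : p.IsPath) : ∃ n, G.Chain n a b (G.treeDist a b) := by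
  induction p with
  | nil => exact ⟨0, (Chain.nil _).cast rfl (treeDist_self _).symm⟩
  | @cons a c b h p ih =>
    rw [SimpleGraph.Walk.cons_isPath_iff] at hp
    obtain ⟨n, hn⟩ := ih hp.1
    have he : s(a, c) ∈ G.graph.edgeSet := h
    obtain ⟨ha, hc⟩ := mem_closedEdge_of_adj h
    refine ⟨1 + n, ((Chain.single he ha hc).append hn).cast rfl ?_⟩
    rw [← treeDist_of_mem hG he ha hc, ← treeDist_add]
    intro f hf
    by_cases hfe : f = s(a, c)
    · right
      subst hfe
      refine edgeProj_eq_of_reachable (fun h' => G.notMem_verts hf h' c.2)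
        (fun h' => G.notMem_verts hf h' b.2) ?_
      rw [G.lowerVert_coe, G.lowerVert_coe]
      -- The rest of the path avoids the vertex `a`, hence also the edge `s(a, c)`.
      exact (p.toDeleteEdge _ fun h' => hp.2 (p.fst_mem_support_of_mem_edges h')).reachable
    · exact Or.inl (edgeProj_eq_of_ne hf he (Ne.symm hfe) ha hc)

/-- A point on an edge is separated by one of the end vertices from every point off the edge. -/
lemma exists_treeDist_add (hG : G.graph.IsAcyclic) {e : Sym2 G.verts} (he : e ∈ G.graph.edgeSet)
    {x y : X} (hx : x ∈ G.edgePts e) (hy : y ∉ G.edgePts e) :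
    ∃ v : G.verts, (v : X) ∈ G.closedEdge e ∧
      G.treeDist x y = G.treeDist x v + G.treeDist v y := by
  obtain ⟨v, hv, hvy⟩ : ∃ v : G.verts, (v : X) ∈ G.closedEdge e ∧
      G.edgeProj e v = G.edgeProj e y := by
    rcases edgeProj_of_notMem hy with h | h
    · exact ⟨G.tail e, tail_mem_closedEdge e, by rw [edgeProj_tail hG he, h]⟩
    · exact ⟨G.head e, head_mem_closedEdge e, by rw [edgeProj_head he, h]⟩
  refine ⟨v, hv, treeDist_add fun f hf => ?_⟩
  by_cases hfe : f = e
  · subst hfe; exact Or.inr hvy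
  · exact Or.inl (edgeProj_eq_of_ne hf he (Ne.symm hfe) (Or.inl hx) hv)

lemma exists_chain_treeDist (hG : G.graph.IsTree) (x y : X) :
    ∃ n, G.Chain n x y (G.treeDist x y) := by
  have hac := hG.isAcyclic
  have hvv : ∀ a b : G.verts, ∃ n, G.Chain n a b (G.treeDist a b) := fun a b => by
    classical
    obtain ⟨p⟩ := G.connected.preconnected a b
    exact exists_chain_treeDist_of_walk hac p.bypass p.bypass_isPath
  have hxv : ∀ (x : X) (b : G.verts), ∃ n, G.Chain n x b (G.treeDist x b) := fun x b => by
    rcases G.cover x with hx | ⟨e, he, hx⟩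
    · exact hvv ⟨x, hx⟩ b
    · obtain ⟨v, hv, hadd⟩ := exists_treeDist_add hac he hx fun h => G.notMem_verts he h b.2
      obtain ⟨n, hn⟩ := hvv v b
      rw [hadd, treeDist_of_mem hac he (Or.inl hx) hv]
      exact ⟨1 + n, (Chain.single he (Or.inl hx) hv).append hn⟩
  rcases G.cover y with hy | ⟨e, he, hy⟩
  · exact hxv x ⟨y, hy⟩
  · by_cases hx : x ∈ G.edgePts e
    · rw [treeDist_of_mem hac he (Or.inl hx) (Or.inl hy)]
      exact ⟨1, Chain.single he (Or.inl hx) (Or.inl hy)⟩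
    · obtain ⟨v, hv, hadd⟩ := exists_treeDist_add hac he hy hx
      obtain ⟨n, hn⟩ := hxv x v
      rw [treeDist_comm, hadd, treeDist_of_mem hac he (Or.inl hy) hv]
      refine ⟨1 + n, ((Chain.single he (Or.inl hy) hv).append ?_).symm⟩
      rw [treeDist_comm]
      exact hn.symm

lemma isShiftedVariogram_of_isEuclideanTree (hG : G.IsEuclideanTree) :
    IsShiftedVariogram 0 G.geodesicDist := by
  classical
  exact isShiftedVariogram_geodesicDist
    (IsCND.sum _ fun e he => isCND_abs_sub_comp (G.len_pos (SimpleGraph.mem_edgeFinset.1 he))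
      (edgeProj_mem_Icc (SimpleGraph.mem_edgeFinset.1 he)))
    treeDist_self treeDist_triangle
    (fun _ he _ hx _ hy => (treeDist_of_mem hG.isAcyclic he hx hy).le)
    (exists_chain_treeDist hG)

end EuclideanGraph

/-! ### Euclidean cycles: arc length on a circle. -/

namespace RadialKernel

/-- Equals 2 (min(s, t) − s t + (s − 1/2)(t − 1/2)); this is the kernel on a rescaled half-circle.
-/
lemma posSemidef_half_sub_abs :
    (Matrix.of fun s t : Icc (0 : ℝ) 1 => 1 / 2 - |(s : ℝ) - t|).PosSemidef := by
  refine posSemidef_congr (posSemidef_const_mul (posSemidef_add posSemidef_brownianBridge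
    (posSemidef_rankOne fun s : Icc (0 : ℝ) 1 => (s : ℝ) - 1 / 2)) zero_le_two) fun s t => ?_
  rcases le_total (s : ℝ) t with h | h
  · rw [abs_of_nonpos (by linarith), min_eq_left h]; ring
  · rw [abs_of_nonneg (by linarith), min_eq_right h]; ring

lemma norm_sub_eq_of_le_half {L s t : ℝ} (hL : 0 < L) (hs : s ∈ Icc 0 (L / 2))
    (ht : t ∈ Icc 0 (L / 2)) :
    ‖(s : AddCircle L) - t‖ = |s - t| ∧ ‖((s + L / 2 : ℝ) : AddCircle L) - t‖ = L / 2 - |s - t| := by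
  have hn : ∀ x : ℝ, |x| ≤ L / 2 → ‖(x : AddCircle L)‖ = |x| := fun x hx =>
    (AddCircle.norm_coe_eq_abs_iff L hL.ne').2 (by rwa [abs_of_pos hL])
  rw [← AddCircle.coe_sub, ← AddCircle.coe_sub]
  refine ⟨hn _ (abs_le.2 ⟨by linarith [hs.1, ht.2], by linarith [hs.2, ht.1]⟩), ?_⟩
  rcases le_total s t with h | h
  · rw [hn _ (abs_le.2 ⟨by linarith [hs.1, ht.2], by linarith [hs.2, ht.1]⟩),
      abs_of_nonpos (sub_nonpos.2 h), abs_of_nonneg (by linarith [hs.1, ht.2])]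
    ring
  · have : ((s + L / 2 - t : ℝ) : AddCircle L) = ((s - L / 2 - t : ℝ) : AddCircle L) := by
      rw [show s + L / 2 - t = s - L / 2 - t + L by ring, AddCircle.coe_add_period]
    rw [this, hn _ (abs_le.2 ⟨by linarith [hs.1, ht.2], by linarith [hs.2, ht.1]⟩),
      abs_of_nonneg (sub_nonneg.2 h), abs_of_nonpos (by linarith [hs.2, ht.1])]
    ring

/-- The arc length metric of a circle. -/
lemma isCND_addCircle {L : ℝ} (hL : 0 < L) : IsCND fun a b : AddCircle L => ‖a - b‖ := by
  -- Every point lies on the half-circle [0, L/2], or is the antipode of a point of it; σ records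
  -- which.
  have hrep : ∀ a : AddCircle L, ∃ (σ : Bool) (s : Icc (0 : ℝ) 1),
      a = ((if σ then L / 2 * s + L / 2 else L / 2 * s : ℝ) : AddCircle L) := fun a => by
    have : Fact (0 < L) := ⟨hL⟩
    obtain ⟨x, hx, rfl⟩ : ∃ x ∈ Ico (0 : ℝ) L, (x : AddCircle L) = a := by
      have := AddCircle.coe_image_Ico_eq L 0
      rw [zero_add] at this
      have ha : a ∈ ((↑) : ℝ → AddCircle L) '' Ico 0 L := by rw [this]; trivial
      exact ha
    rcases le_total x (L / 2) with h | h
    · refine ⟨false, ⟨x / (L / 2), div_nonneg hx.1 (by positivity),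
        (div_le_one (by positivity)).2 h⟩, ?_⟩
      simp only [Bool.false_eq_true, if_false]
      rw [mul_div_cancel₀ _ (by positivity)]
    · refine ⟨true, ⟨(x - L / 2) / (L / 2), div_nonneg (by linarith) (by positivity),
        (div_le_one (by positivity)).2 (by linarith [hx.2])⟩, ?_⟩
      simp only [if_true]
      rw [mul_div_cancel₀ _ (by positivity), sub_add_cancel]
  choose σ s hs using hrep
  have hk : (Matrix.of fun a b : AddCircle L => L / 4 - ‖a - b‖).PosSemidef := by
    -- Passing to the antipode replaces a distance by L/2 minus it, which flips the sign of L/4 − ‖a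
    -- − b‖. The kernel is thus the half-circle kernel multiplied by the signs of its arguments.
    refine posSemidef_congr (posSemidef_const_mul (posSemidef_mul
      (posSemidef_rankOne fun a => if σ a then (1 : ℝ) else -1)
      (posSemidef_comp posSemidef_half_sub_abs s)) (half_pos hL).le) fun a b => ?_
    have hmem : ∀ s : Icc (0 : ℝ) 1, L / 2 * (s : ℝ) ∈ Icc 0 (L / 2) := fun s =>
      ⟨mul_nonneg (by positivity) s.2.1, mul_le_of_le_one_right (by positivity) s.2.2⟩
    have hab := norm_sub_eq_of_le_half hL (hmem (s a)) (hmem (s b))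
    have hba := norm_sub_eq_of_le_half hL (hmem (s b)) (hmem (s a))
    rw [← mul_sub, abs_mul, abs_of_pos (half_pos hL)] at hab hba
    have hnorm : ‖a - b‖ = ‖((if σ a then L / 2 * s a + L / 2 else L / 2 * s a : ℝ) : AddCircle L)
        - ((if σ b then L / 2 * s b + L / 2 else L / 2 * s b : ℝ) : AddCircle L)‖ := by
      rw [← hs a, ← hs b]
    rw [hnorm]
    cases hσa : σ a <;> cases hσb : σ b
    · simp only [Bool.false_eq_true, if_false]
      rw [hab.1]; ring
    · simp only [Bool.false_eq_true, if_false, if_true]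
      rw [norm_sub_rev, hba.2, abs_sub_comm]; ring
    · simp only [Bool.false_eq_true, if_false, if_true]
      rw [hab.2]; ring
    · simp only [if_true]
      rw [AddCircle.coe_add, AddCircle.coe_add, add_sub_add_right_eq_sub, hab.1]; ring
  exact ((IsCND.of_posSemidef hk).add_const (L / 4)).congr fun a b => by ring

end RadialKernel

namespace EuclideanGraph

open RadialKernel

variable {X : Type u} {G : EuclideanGraph X}

/-- A cyclic enumeration `w 0, …, w N = w 0` of the vertices along a cycle. -/
structure IsCyclicEnum (w : ℕ → G.verts) (N : ℕ) : Prop where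
  three_le : 3 ≤ N
  adj : ∀ k, G.graph.Adj (w k) (w (k + 1))
  period : w N = w 0
  inj : ∀ j < N, ∀ k < N, w j = w k → j = k
  surj : ∀ v, ∃ k < N, w k = v
  edge_surj : ∀ e ∈ G.graph.edgeSet, ∃ k < N, s(w k, w (k + 1)) = e

lemma sub_mod_eq_one_iff {N a b : ℕ} (hN : 3 ≤ N) (ha : a < N) (hb : b < N) :
    (N - b + a) % N = 1 ↔ a = (b + 1) % N := by
  rcases Nat.lt_or_ge (b + 1) N with h | h
  · rw [Nat.mod_eq_of_lt h]
    rcases Nat.lt_or_ge (N - b + a) N with h' | h'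
    · rw [Nat.mod_eq_of_lt h']; omega
    · rw [Nat.mod_eq_sub_mod h', Nat.mod_eq_of_lt (by omega)]; omega
  · obtain rfl : N = b + 1 := by omega
    rw [Nat.mod_self]
    rcases Nat.lt_or_ge (b + 1 - b + a) (b + 1) with h' | h'
    · rw [Nat.mod_eq_of_lt h']; omega
    · rw [Nat.mod_eq_sub_mod h', Nat.mod_eq_of_lt (by omega)]; omega

lemma exists_isCyclicEnum (hG : G.IsEuclideanCycle) :
    ∃ (w : ℕ → G.verts) (N : ℕ), IsCyclicEnum w N := by
  obtain ⟨N, hN, ⟨φ⟩⟩ := hG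
  have hpos : 0 < N := by omega
  have hadj : ∀ a b : Fin N, (SimpleGraph.cycleGraph N).Adj a b ↔
      (a : ℕ) = (b + 1) % N ∨ (b : ℕ) = (a + 1) % N := fun a b => by
    rw [SimpleGraph.cycleGraph_adj', Fin.val_sub, Fin.val_sub,
      sub_mod_eq_one_iff hN a.2 b.2, sub_mod_eq_one_iff hN b.2 a.2]
  set w : ℕ → G.verts := fun k => φ.symm ⟨k % N, Nat.mod_lt k hpos⟩ with hw
  have hwv : ∀ v, w (φ v) = v := fun v => by
    rw [hw]
    simp only [Nat.mod_eq_of_lt (φ v).2]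
    exact φ.symm_apply_apply v
  have hwmod : ∀ k, w (k % N) = w k := fun k => by simp [hw]
  refine ⟨w, N, hN, fun k => ?_, by simp [hw], fun j hj k hk h => ?_, fun v => ⟨φ v, (φ v).2, hwv v⟩,
    fun e he => ?_⟩
  · rw [hw, φ.symm.map_adj_iff, hadj]
    right
    simp
  · have := φ.symm.injective h
    rwa [Fin.mk.injEq, Nat.mod_eq_of_lt hj, Nat.mod_eq_of_lt hk] at this
  · have h := (φ.map_adj_iff.2 (G.adj_tail_head he))
    rw [hadj] at h
    rw [G.endpoints e he]
    rcases h with h | h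
    · refine ⟨φ (G.head e), (φ _).2, ?_⟩
      rw [hwv, ← hwmod, ← h, hwv, Sym2.eq_swap]
    · refine ⟨φ (G.tail e), (φ _).2, ?_⟩
      rw [hwv, ← hwmod (_ + 1), ← h, hwv]

/-- The `k`-th edge of a cyclic enumeration of the vertices. -/
def cycEdge (w : ℕ → G.verts) (k : ℕ) : Sym2 G.verts := s(w k, w (k + 1))

/-- The distance of the `k`-th from the initial vertex along the cycle. -/
def cycSum (w : ℕ → G.verts) (k : ℕ) : ℝ := ∑ i ∈ Finset.range k, G.len (cycEdge w i)

open Classical in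
/-- The distance from the `k`-th vertex of a point on the `k`-th edge. -/
def cycOffset (w : ℕ → G.verts) (k : ℕ) (x : X) : ℝ :=
  if G.tail (cycEdge w k) = w k then G.coord (cycEdge w k) x - G.lo (cycEdge w k)
  else G.hi (cycEdge w k) - G.coord (cycEdge w k) x

lemma cycSum_succ (w : ℕ → G.verts) (k : ℕ) :
    cycSum w (k + 1) = cycSum w k + G.len (cycEdge w k) := Finset.sum_range_succ _ _

lemma abs_cycOffset_sub (w : ℕ → G.verts) (k : ℕ) (x y : X) :
    |cycOffset w k x - cycOffset w k y| =
      |G.coord (cycEdge w k) x - G.coord (cycEdge w k) y| := by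
  unfold cycOffset
  split_ifs
  · rw [sub_sub_sub_cancel_right]
  · rw [sub_sub_sub_cancel_left, abs_sub_comm]

namespace IsCyclicEnum

variable {w : ℕ → G.verts} {N : ℕ} (h : IsCyclicEnum w N)

include h

lemma cycEdge_mem (k : ℕ) : cycEdge w k ∈ G.graph.edgeSet := h.adj k

/-- Equality with reversed ends would return to `w k` after two steps, which `3 ≤ N` excludes. -/
lemma cycEdge_inj {j k : ℕ} (hj : j < N) (hk : k < N) (he : cycEdge w j = cycEdge w k) :
    j = k := by
  have h3 := h.three_le
  rcases Sym2.eq_iff.1 he with ⟨h1, _⟩ | ⟨h1, h2⟩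
  · exact h.inj j hj k hk h1
  · rcases Nat.lt_or_ge (k + 1) N with hk1 | hk1
    · obtain rfl := h.inj j hj (k + 1) hk1 h1
      rcases Nat.lt_or_ge (k + 1 + 1) N with hk2 | hk2
      · have := h.inj _ hk2 k hk h2
        omega
      · obtain rfl : N = k + 1 + 1 := by omega
        rw [h.period] at h2
        have := h.inj 0 (by omega) k hk h2
        omega
    · obtain rfl : N = k + 1 := by omega
      rw [h.period] at h1
      obtain rfl := h.inj j hj 0 (by omega) h1
      have := h.inj 1 (by omega) k hk h2
      omega

lemma tail_head (k : ℕ) :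
    (G.tail (cycEdge w k) = w k ∧ G.head (cycEdge w k) = w (k + 1)) ∨
      (G.tail (cycEdge w k) ≠ w k ∧ G.tail (cycEdge w k) = w (k + 1) ∧
        G.head (cycEdge w k) = w k) := by
  have he := h.cycEdge_mem k
  have hne := G.tail_ne_head he
  have h1 := G.endpoints _ he
  rcases Sym2.eq_iff.1 (show s(w k, w (k + 1)) = _ from h1) with ⟨h1, h2⟩ | ⟨h1, h2⟩
  · exact Or.inl ⟨h1.symm, h2.symm⟩
  · exact Or.inr ⟨fun h' => hne (h'.trans h1), h2.symm, h1.symm⟩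

lemma cycOffset_left (k : ℕ) : cycOffset w k (w k) = 0 := by
  have he := h.cycEdge_mem k
  rcases h.tail_head k with ⟨h1, h2⟩ | ⟨h0, h1, h2⟩
  · have ht := G.coord_tail _ he
    rw [h1] at ht
    rw [cycOffset, if_pos h1, ht, sub_self]
  · have hh := G.coord_head _ he
    rw [h2] at hh
    rw [cycOffset, if_neg h0, hh, sub_self]

lemma cycOffset_right (k : ℕ) : cycOffset w k (w (k + 1)) = G.len (cycEdge w k) := by
  have he := h.cycEdge_mem k
  rcases h.tail_head k with ⟨h1, h2⟩ | ⟨h0, h1, h2⟩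
  · rw [cycOffset, if_pos h1, ← h2, G.coord_head _ he, len]
  · rw [cycOffset, if_neg h0, ← h1, G.coord_tail _ he, len]

lemma left_mem (k : ℕ) : (w k : X) ∈ G.closedEdge (cycEdge w k) := (mem_closedEdge_of_adj (h.adj k)).1

lemma right_mem (k : ℕ) : (w (k + 1) : X) ∈ G.closedEdge (cycEdge w k) :=
  (mem_closedEdge_of_adj (h.adj k)).2

lemma mem_closedEdge {k : ℕ} {x : X} (hx : x ∈ G.closedEdge (cycEdge w k)) :
    x ∈ G.edgePts (cycEdge w k) ∨ x = w k ∨ x = w (k + 1) := by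
  rcases hx with hx | rfl | rfl
  · exact Or.inl hx
  · rcases h.tail_head k with ⟨h1, h2⟩ | ⟨h0, h1, h2⟩
    · exact Or.inr (Or.inl (congrArg _ h1))
    · exact Or.inr (Or.inr (congrArg _ h1))
  · rcases h.tail_head k with ⟨h1, h2⟩ | ⟨h0, h1, h2⟩
    · exact Or.inr (Or.inr (congrArg _ h2))
    · exact Or.inr (Or.inl (congrArg _ h2))

lemma cycOffset_mem_Ioo {k : ℕ} {x : X} (hx : x ∈ G.edgePts (cycEdge w k)) :
    cycOffset w k x ∈ Ioo 0 (G.len (cycEdge w k)) := by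
  have hm := (G.coord_bijOn _ (h.cycEdge_mem k)).mapsTo hx
  unfold cycOffset len
  split_ifs
  · exact ⟨by linarith [hm.1], by linarith [hm.2]⟩
  · exact ⟨by linarith [hm.2], by linarith [hm.1]⟩

open Classical in
/-- The position of a point of a cycle, measured from the initial vertex. -/
def position (x : X) : ℝ :=
  if hx : x ∈ G.verts then cycSum w (h.surj ⟨x, hx⟩).choose
  else cycSum w (h.edge_surj _ (G.edgeOf_mem hx)).choose +
    cycOffset w (h.edge_surj _ (G.edgeOf_mem hx)).choose x

lemma position_vert {k : ℕ} (hk : k < N) : h.position (w k) = cycSum w k := by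
  have hs := (h.surj ⟨w k, (w k).2⟩).choose_spec
  rw [position, dif_pos (w k).2, h.inj _ hs.1 k hk hs.2]

lemma position_edge {k : ℕ} (hk : k < N) {x : X} (hx : x ∈ G.edgePts (cycEdge w k)) :
    h.position x = cycSum w k + cycOffset w k x := by
  have hx' := G.notMem_verts (h.cycEdge_mem k) hx
  have hs := (h.edge_surj _ (G.edgeOf_mem hx')).choose_spec
  rw [position, dif_neg hx', h.cycEdge_inj hs.1 hk (hs.2.trans (G.edgeOf_eq (h.cycEdge_mem k) hx hx'))]

/-- A vertex is assigned to the edge that starts at it, so the offset stays strictly below the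
length. -/
lemma exists_position (x : X) : ∃ k < N, x ∈ G.closedEdge (cycEdge w k) ∧
    0 ≤ cycOffset w k x ∧ cycOffset w k x < G.len (cycEdge w k) ∧
      h.position x = cycSum w k + cycOffset w k x := by
  rcases G.cover x with hx | ⟨e, he, hx⟩
  · obtain ⟨k, hk, hkx⟩ := h.surj ⟨x, hx⟩
    obtain rfl : (w k : X) = x := congrArg Subtype.val hkx
    refine ⟨k, hk, h.left_mem k, ?_⟩
    rw [h.cycOffset_left, h.position_vert hk]
    exact ⟨le_rfl, G.len_pos (h.cycEdge_mem k), (add_zero _).symm⟩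
  · obtain ⟨k, hk, rfl⟩ := h.edge_surj e he
    have hm := h.cycOffset_mem_Ioo hx
    exact ⟨k, hk, Or.inl hx, hm.1.le, hm.2, h.position_edge hk hx⟩

/-- Valid only modulo the total length: the end of the last edge is the initial vertex, with
position 0 instead of `cycSum w N`. -/
lemma coe_position {k : ℕ} (hk : k < N) {x : X} (hx : x ∈ G.closedEdge (cycEdge w k)) :
    (h.position x : AddCircle (cycSum w N)) = ((cycSum w k + cycOffset w k x : ℝ) :
      AddCircle (cycSum w N)) := by
  rcases h.mem_closedEdge hx with hx | rfl | rfl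
  · rw [h.position_edge hk hx]
  · rw [h.position_vert hk, h.cycOffset_left, add_zero]
  · rw [h.cycOffset_right, ← cycSum_succ]
    rcases Nat.lt_or_ge (k + 1) N with hk1 | hk1
    · rw [h.position_vert hk1]
    · obtain rfl : N = k + 1 := by omega
      have h0 : cycSum w 0 = 0 := by simp [cycSum]
      rw [h.period, h.position_vert (by omega), AddCircle.coe_period, h0]
      rfl

lemma cycSum_mono : Monotone (cycSum w) :=
  monotone_nat_of_le_succ fun k => by
    rw [cycSum_succ]
    linarith [G.len_pos (h.cycEdge_mem k)]

lemma cycSum_pos : 0 < cycSum w N := by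
  have h1 := h.cycSum_mono (show 1 ≤ N by have := h.three_le; omega)
  have h2 := G.len_pos (h.cycEdge_mem 0)
  have h3 : cycSum w 1 = G.len (cycEdge w 0) := by simp [cycSum]
  linarith

lemma chain_vert {k l : ℕ} (hkl : k ≤ l) :
    ∃ n, G.Chain n (w k) (w l) (cycSum w l - cycSum w k) := by
  induction l, hkl using Nat.le_induction with
  | base => exact ⟨0, (Chain.nil _).cast rfl (sub_self _).symm⟩
  | succ l _ ih =>
    obtain ⟨n, hn⟩ := ih
    refine ⟨n + 1, (hn.append (Chain.single (h.cycEdge_mem l) (h.left_mem l) (h.right_mem l))).cast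
      rfl ?_⟩
    rw [← abs_cycOffset_sub, h.cycOffset_left, h.cycOffset_right, cycSum_succ, zero_sub, abs_neg,
      abs_of_pos (G.len_pos (h.cycEdge_mem l))]
    ring

lemma chain_left {k : ℕ} {x : X} (hx : x ∈ G.closedEdge (cycEdge w k)) (h0 : 0 ≤ cycOffset w k x) :
    G.Chain 1 (w k) x (cycOffset w k x) := by
  refine (Chain.single (h.cycEdge_mem k) (h.left_mem k) hx).cast rfl ?_
  rw [← abs_cycOffset_sub, h.cycOffset_left, zero_sub, abs_neg, abs_of_nonneg h0]

lemma chain_right {k : ℕ} {x : X} (hx : x ∈ G.closedEdge (cycEdge w k))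
    (h1 : cycOffset w k x < G.len (cycEdge w k)) :
    G.Chain 1 x (w (k + 1)) (G.len (cycEdge w k) - cycOffset w k x) := by
  refine (Chain.single (h.cycEdge_mem k) hx (h.right_mem k)).cast rfl ?_
  rw [← abs_cycOffset_sub, h.cycOffset_right, abs_sub_comm, abs_of_pos (by linarith)]

lemma chain_forward {x y : X} (hxy : h.position x ≤ h.position y) :
    ∃ n, G.Chain n x y (h.position y - h.position x) := by
  obtain ⟨k, hk, hx, hx0, hx1, ex⟩ := h.exists_position x
  obtain ⟨l, hl, hy, hy0, hy1, ey⟩ := h.exists_position y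
  rcases lt_trichotomy k l with hkl | rfl | hkl
  · obtain ⟨n, hn⟩ := h.chain_vert (show k + 1 ≤ l from hkl)
    refine ⟨_, (((h.chain_right hx hx1).append hn).append (h.chain_left hy hy0)).cast rfl ?_⟩
    rw [ex, ey, cycSum_succ]
    ring
  · refine ⟨1, (Chain.single (h.cycEdge_mem k) hx hy).cast rfl ?_⟩
    rw [← abs_cycOffset_sub, abs_sub_comm, abs_of_nonneg (by linarith), ex, ey]
    ring
  · have := h.cycSum_mono (show l + 1 ≤ k from hkl)
    rw [cycSum_succ] at this
    linarith

/-- The complementary arc: onwards from `y` to the closing vertex `w N = w 0`, then on to `x`. -/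
lemma chain_backward (x y : X) :
    ∃ n, G.Chain n y x (cycSum w N - (h.position y - h.position x)) := by
  obtain ⟨k, hk, hx, hx0, hx1, ex⟩ := h.exists_position x
  obtain ⟨l, hl, hy, hy0, hy1, ey⟩ := h.exists_position y
  obtain ⟨n, hn⟩ := h.chain_vert (show l + 1 ≤ N from hl)
  obtain ⟨m, hm⟩ := h.chain_vert (Nat.zero_le k)
  rw [h.period] at hn
  refine ⟨_, ((((h.chain_right hy hy1).append hn).append hm).append (h.chain_left hx hx0)).cast
    rfl ?_⟩
  have h0 : cycSum w 0 = 0 := by simp [cycSum]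
  rw [ex, ey, cycSum_succ, h0]
  ring

lemma position_mem_Ico (x : X) : h.position x ∈ Ico 0 (cycSum w N) := by
  obtain ⟨k, hk, hx, hx0, hx1, ex⟩ := h.exists_position x
  have h1 := h.cycSum_mono (Nat.zero_le k)
  have h2 := h.cycSum_mono (show k + 1 ≤ N from hk)
  have h0 : cycSum w 0 = 0 := by simp [cycSum]
  rw [cycSum_succ] at h2
  rw [ex]
  exact ⟨by linarith, by linarith⟩

/-- The arc length distance of two points of a cycle. -/
def arcDist (x y : X) : ℝ :=
  ‖(h.position x : AddCircle (cycSum w N)) - (h.position y : AddCircle (cycSum w N))‖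

lemma arcDist_comm (x y : X) : h.arcDist x y = h.arcDist y x := norm_sub_rev _ _

lemma exists_chain_arcDist (x y : X) : ∃ n, G.Chain n x y (h.arcDist x y) := by
  wlog hxy : h.position x ≤ h.position y generalizing x y
  · obtain ⟨n, hn⟩ := this y x (not_le.1 hxy).le
    exact ⟨n, hn.symm.cast rfl (h.arcDist_comm _ _)⟩
  have hL := h.cycSum_pos
  have hx := h.position_mem_Ico x
  have hy := h.position_mem_Ico y
  have hn : ∀ t : ℝ, |t| ≤ cycSum w N / 2 → ‖(t : AddCircle (cycSum w N))‖ = |t| := fun t ht =>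
    (AddCircle.norm_coe_eq_abs_iff _ hL.ne').2 (by rwa [abs_of_pos hL])
  rw [h.arcDist_comm, arcDist, ← AddCircle.coe_sub]
  -- The arc distance is the length of the shorter of the two arcs; beyond half the circumference a
  -- period is subtracted.
  rcases le_total (h.position y - h.position x) (cycSum w N / 2) with ht | ht
  · rw [hn _ (by rwa [abs_of_nonneg (by linarith)]), abs_of_nonneg (by linarith)]
    exact h.chain_forward hxy
  · have hper := AddCircle.coe_add_period (cycSum w N) (h.position y - h.position x - cycSum w N)
    rw [sub_add_cancel] at hper
    rw [hper, hn _ (by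
        rw [abs_of_nonpos (by linarith [hx.1, hy.2])]; linarith),
      abs_of_nonpos (by linarith [hx.1, hy.2])]
    obtain ⟨n, hn⟩ := h.chain_backward x y
    exact ⟨n, hn.symm.cast rfl (by ring)⟩

lemma arcDist_le_of_mem {e : Sym2 G.verts} (he : e ∈ G.graph.edgeSet) {x y : X}
    (hx : x ∈ G.closedEdge e) (hy : y ∈ G.closedEdge e) :
    h.arcDist x y ≤ |G.coord e x - G.coord e y| := by
  obtain ⟨k, hk, rfl⟩ := h.edge_surj e he
  have h1 := abs_cycOffset_sub w k x y
  unfold cycEdge at h1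
  rw [← h1, arcDist, h.coe_position hk hx, h.coe_position hk hy, ← AddCircle.coe_sub,
    add_sub_add_left_eq_sub]
  exact QuotientAddGroup.norm_mk_le_norm

end IsCyclicEnum

lemma isShiftedVariogram_of_isEuclideanCycle (hG : G.IsEuclideanCycle) :
    IsShiftedVariogram 0 G.geodesicDist := by
  obtain ⟨w, N, h⟩ := exists_isCyclicEnum hG
  exact isShiftedVariogram_geodesicDist
    ((isCND_addCircle h.cycSum_pos).comp fun x => (h.position x : AddCircle (cycSum w N)))
    (fun x => by rw [sub_self, norm_zero]) (fun x y z => norm_sub_le_norm_sub_add_norm_sub _ _ _)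
    (fun _ he _ hx _ hy => h.arcDist_le_of_mem he hx hy) h.exists_chain_arcDist

end EuclideanGraph

/-! ### Sequential 1-sums and the main theorem. -/

open RadialKernel in
lemma IsSeqOneSum.isShiftedVariogram {X : Type u} {d : X → X → ℝ} (h : IsSeqOneSum X d) :
    IsShiftedVariogram 0 d := by
  have hcomp : ∀ {Y : Type u} (H : EuclideanGraph Y),
      H.IsEuclideanCycle ∨ H.IsEuclideanTree → IsShiftedVariogram 0 H.geodesicDist := fun H hH =>
    hH.elim EuclideanGraph.isShiftedVariogram_of_isEuclideanCycle
      EuclideanGraph.isShiftedVariogram_of_isEuclideanTree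
  induction h with
  | single d H hH hd =>
    obtain rfl : d = H.geodesicDist := funext₂ hd
    exact hcomp H hH
  | @oneSum X d A B x₀ hunion hinter hA H hH hB hAB hBA ih =>
    classical
    have hdB : IsShiftedVariogram 0 fun x y : B => d x y := by
      obtain h : (fun x y : B => d x y) = H.geodesicDist := funext₂ hB
      rw [h]
      exact hcomp H hH
    have hx₀ : x₀ ∈ A ∩ B := by rw [hinter]; rfl
    have hcov : ∀ x, x ∈ A ∨ x ∈ B := fun x => by
      have : x ∈ A ∪ B := by rw [hunion]; trivial
      exact this
    have hAB' : ∀ x, x ∈ A → x ∈ B → x = x₀ := fun x h1 h2 => by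
      have : x ∈ A ∩ B := ⟨h1, h2⟩
      rwa [hinter] at this
    -- Retractions onto the summands: `p` collapses `B` to `x₀`, and `q` collapses `A` to `x₀`.
    set p : X → A := fun x => if hx : x ∈ A then ⟨x, hx⟩ else ⟨x₀, hx₀.1⟩ with hp
    set q : X → B := fun x => if hx : x ∈ B then ⟨x, hx⟩ else ⟨x₀, hx₀.2⟩ with hq
    have hpA : ∀ x, x ∈ A → (p x : X) = x := fun x hx => by simp [hp, hx]
    have hqB : ∀ x, x ∈ B → (q x : X) = x := fun x hx => by simp [hq, hx]
    have hpB : ∀ x, x ∈ B → (p x : X) = x₀ := fun x hx => by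
      by_cases hxA : x ∈ A
      · rw [hpA x hxA, hAB' x hxA hx]
      · simp [hp, hxA]
    have hqA : ∀ x, x ∈ A → (q x : X) = x₀ := fun x hx => by
      by_cases hxB : x ∈ B
      · rw [hqB x hxB, hAB' x hx hxB]
      · simp [hq, hxB]
    have h00 : d x₀ x₀ = 0 := ih.diag ⟨x₀, hx₀.1⟩
    -- The distance splits into the pullbacks along the two retractions, so conditional negative
    -- definiteness is inherited from the summands.
    have hd : ∀ x y, d x y = d (p x) (p y) + d (q x) (q y) := fun x y => by
      rcases hcov x with hx | hx <;> rcases hcov y with hy | hy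
      · rw [hpA x hx, hpA y hy, hqA x hx, hqA y hy, h00, add_zero]
      · rw [hpA x hx, hpB y hy, hqA x hx, hqB y hy, hAB x hx y hy]
      · have h1 : d x₀ x = d x x₀ := hdB.cnd.1 ⟨x₀, hx₀.2⟩ ⟨x, hx⟩
        have h2 : d y x₀ = d x₀ y := ih.cnd.1 ⟨y, hy⟩ ⟨x₀, hx₀.1⟩
        rw [hpB x hx, hpA y hy, hqB x hx, hqA y hy, hBA y hy x hx, h1, h2]
      · rw [hpB x hx, hpB y hy, hqB x hx, hqB y hy, h00, zero_add]
    refine ⟨((ih.cnd.comp p).add (hdB.cnd.comp q)).congr hd, le_rfl, fun x => ?_, fun x y hxy => ?_⟩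
    · have h1 := ih.diag (p x)
      have h2 := hdB.diag (q x)
      rw [hd, h1, h2, add_zero]
    · have h1 := ih.apply_nonneg (p x) (p y)
      have h2 := hdB.apply_nonneg (q x) (q y)
      rw [hd]
      by_cases hpq : p x = p y
      -- The two retractions jointly separate points: for `x` and `y` in different summands,
      -- agreement under both forces `x = x₀ = y`.
      · have hq : q x ≠ q y := fun hq => hxy (by
          have e1 := congrArg Subtype.val hpq
          have e2 := congrArg Subtype.val hq
          rcases hcov x with hx | hx <;> rcases hcov y with hy | hy
          · rwa [hpA x hx, hpA y hy] at e1
          · rw [hpA x hx, hpB y hy] at e1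
            rw [hqA x hx, hqB y hy] at e2
            exact e1.trans e2
          · rw [hpB x hx, hpA y hy] at e1
            rw [hqB x hx, hqA y hy] at e2
            exact e2.trans e1
          · rwa [hqB x hx, hqB y hy] at e2)
        have := hdB.lt _ _ hq
        linarith
      · have := ih.lt _ _ hpq
        linarith

end

theorem mainTheorem1 {X : Type u} (G : EuclideanGraph X) (C : ℝ → ℝ) (hC : IsRadialProfile C) :
    (∀ o : G.verts, IsStrictlyPosDef fun x y : X => C (G.resistanceDist o x y)) ∧
      (IsSeqOneSum X G.geodesicDist →
        IsStrictlyPosDef fun x y : X => C (G.geodesicDist x y)) :=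
  ⟨fun o => RadialKernel.posDef_of_isRadialProfile (G.isShiftedVariogram_resistanceDist o) hC,
    fun h => RadialKernel.posDef_of_isRadialProfile h.isShiftedVariogram hC⟩
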